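/- Let $(M,g)$ be a smooth, complete (connected) Riemannian manifold of dimension $n\ge 2$, with Riemannian measure $\mu$ (in any chart $d\mu=\sqrt{\det(g_{ij})}\,dm$, $dm$ the Lebesgue measure); all norms below are $L^r(M,\mu)$ norms. Let $1\le p<n$, $q=\frac{np}{n-p}$, $0<\alpha\le 1$ and $A>0$. Let $W^{1,p}(M)$ be the completion of the space of functions $\varphi\in C^\infty(M)$ with $\|\varphi\|_p+\|\nabla\varphi\|_p<\infty$ under this norm and, for $\Omega\subseteq M$ open, let $W^{1,p}_0(\Omega)$ be the closure of $C_c^\infty(\Omega)$ in it (functions on $\Omega$ being extended by zero). Suppose that there are $\tau>0$ and $B\ge 0$ such that for every open set $\Omega\subseteq M$ with $\mu(\Omega)\le\tau$ $$\|u\|_q^\alpha\le A\|\nabla u\|_p^\alpha+B\|u\|_p^\alpha\qquad\text{for all } u\in W^{1,p}_0(\Omega).$$ Then there is $B'\ge 0$ such that, with the same constant $A$, $$\|u\|_q^\alpha\le A\|\nabla u\|_p^\alpha+B'\|u\|_p^\alpha\qquad\text{for all } u\in W^{1,p}(M).$$ -/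

import Mathlib

open scoped Manifold ContDiff Bundle Topology ENNReal

noncomputable section

namespace RiemannianSobolev

variable {n : ℕ} {M : Type*} [MetricSpace M] [ChartedSpace (EuclideanSpace ℝ (Fin n)) M]
  [Bundle.RiemannianBundle (fun x : M ↦ TangentSpace (𝓡 n) x)]

/-- The `i`-th coordinate vector field `∂ᵢ` of the chart at `x`, at the point of the manifold whose
coordinates are `y`. -/
def coordVector (x : M) (y : EuclideanSpace ℝ (Fin n)) (i : Fin n) :
    TangentSpace (𝓡 n) ((chartAt (EuclideanSpace ℝ (Fin n)) x).symm y) :=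
  mfderiv (𝓡 n) (𝓡 n) (chartAt (EuclideanSpace ℝ (Fin n)) x).symm y
    (EuclideanSpace.single i (1 : ℝ) : EuclideanSpace ℝ (Fin n))

/-- The matrix `g_{ij} = g(∂ᵢ, ∂ⱼ)` of the metric in the chart at `x`, as a function of the
coordinates. -/
def metricMatrix (x : M) (y : EuclideanSpace ℝ (Fin n)) : Matrix (Fin n) (Fin n) ℝ :=
  Matrix.of fun i j ↦ inner ℝ (coordVector x y i) (coordVector x y j)

/-- The measure `√(det g_{ij}) dm` on the domain of the chart at `x`, seen as a measure on `M` that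
vanishes off that domain. -/
def chartVolume [MeasurableSpace M] (x : M) : MeasureTheory.Measure M :=
  ((MeasureTheory.volume.restrict (chartAt (EuclideanSpace ℝ (Fin n)) x).target).withDensity
    (fun y ↦ ENNReal.ofReal (Real.sqrt (metricMatrix x y).det))).map
    (chartAt (EuclideanSpace ℝ (Fin n)) x).symm

variable (n M) in
/-- The Riemannian measure. By the change of variables formula, the measures `chartVolume x` agree
on the overlaps of the charts; their supremum (in the complete lattice of measures) is the measure
that restricts to `√(det g_{ij}) dm` on the domain of each chart. -/
def riemannianVolume [MeasurableSpace M] : MeasureTheory.Measure M :=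
  ⨆ x : M, chartVolume (n := n) x

/-- The differential of `φ` at `x`, that is, the gradient of `φ` as a covector. -/
def differential (φ : M → ℝ) (x : M) : TangentSpace (𝓡 n) x →L[ℝ] ℝ :=
  mfderiv (𝓡 n) 𝓘(ℝ, ℝ) φ x

/-- The length of a covector: its operator norm for the Riemannian norm on the tangent space. The
length of the differential of a function is the length of its gradient. -/
def covectorNorm {x : M} (ξ : TangentSpace (𝓡 n) x →L[ℝ] ℝ) : ℝ := ‖ξ‖

/-- `IsSobolevLimit S p u X`: the pair formed by the function `u` and the field of covectors `X`
(the differential of `u`) is a limit, for the norm `‖u‖_p + ‖∇u‖_p`, of smooth functions that belong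
to the class `S`. -/
def IsSobolevLimit [MeasurableSpace M] (S : Set (M → ℝ)) (p : ℝ) (u : M → ℝ)
    (X : (x : M) → TangentSpace (𝓡 n) x →L[ℝ] ℝ) : Prop :=
  MeasureTheory.AEStronglyMeasurable u (riemannianVolume n M) ∧
  ∃ φ : ℕ → M → ℝ,
    (∀ j, φ j ∈ S) ∧
    (∀ j, ContMDiff (𝓡 n) 𝓘(ℝ, ℝ) ∞ (φ j)) ∧
    (∀ j, MeasureTheory.AEStronglyMeasurable (fun x ↦ covectorNorm (X x - differential (φ j) x))
      (riemannianVolume n M)) ∧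
    Filter.Tendsto (fun j ↦ MeasureTheory.eLpNorm (fun x ↦ u x - φ j x) (ENNReal.ofReal p)
      (riemannianVolume n M)) Filter.atTop (𝓝 0) ∧
    Filter.Tendsto (fun j ↦ MeasureTheory.eLpNorm
      (fun x ↦ covectorNorm (X x - differential (φ j) x)) (ENNReal.ofReal p) (riemannianVolume n M)) Filter.atTop (𝓝 0)

/-- `u` belongs to `W^{1,p}(M)`, the completion of the space of smooth functions `φ` with
`‖φ‖_p + ‖∇φ‖_p < ∞`, and its differential is `X`. -/
def MemW [MeasurableSpace M] (p : ℝ) (u : M → ℝ)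
    (X : (x : M) → TangentSpace (𝓡 n) x →L[ℝ] ℝ) : Prop :=
  IsSobolevLimit
    {φ | MeasureTheory.MemLp φ (ENNReal.ofReal p) (riemannianVolume n M) ∧
      MeasureTheory.MemLp (fun x ↦ covectorNorm (differential (n := n) φ x)) (ENNReal.ofReal p)
        (riemannianVolume n M)} p u X

/-- `u` belongs to `W_0^{1,p}(Ω)`, the closure of `C_c^∞(Ω)`, and its differential is `X`; functions
on `Ω` are extended by zero. -/
def MemW₀ [MeasurableSpace M] (Ω : Set M) (p : ℝ) (u : M → ℝ)
    (X : (x : M) → TangentSpace (𝓡 n) x →L[ℝ] ℝ) : Prop :=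
  IsSobolevLimit {φ | HasCompactSupport φ ∧ tsupport φ ⊆ Ω} p u X

/-- `‖u‖_q^α ≤ A ‖∇u‖_p^α + B ‖u‖_p^α`, where `X` is the differential of `u`. -/
def SobolevInequality [MeasurableSpace M] (p q α A B : ℝ) (u : M → ℝ)
    (X : (x : M) → TangentSpace (𝓡 n) x →L[ℝ] ℝ) : Prop :=
  MeasureTheory.eLpNorm u (ENNReal.ofReal q) (riemannianVolume n M) ^ α ≤
    ENNReal.ofReal A *
      MeasureTheory.eLpNorm (fun x ↦ covectorNorm (X x)) (ENNReal.ofReal p)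
        (riemannianVolume n M) ^ α +
    ENNReal.ofReal B *
      MeasureTheory.eLpNorm u (ENNReal.ofReal p) (riemannianVolume n M) ^ α

variable (n M) in
/-- The Sobolev inequality with constant `A` holds for small volumes on `M`. -/
def SobolevForSmallVolumes [MeasurableSpace M] (p q α A : ℝ) : Prop :=
  ∃ τ > 0, ∃ B ≥ 0, ∀ Ω : Set M, IsOpen Ω → riemannianVolume n M Ω ≤ ENNReal.ofReal τ →
    ∀ (u : M → ℝ) (X : (x : M) → TangentSpace (𝓡 n) x →L[ℝ] ℝ),
      MemW₀ Ω p u X → SobolevInequality p q α A B u X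

variable (n M) in
/-- The Sobolev inequality with constant `A` holds globally on `M`. -/
def SobolevGlobally [MeasurableSpace M] (p q α A : ℝ) : Prop :=
  ∃ B ≥ 0, ∀ (u : M → ℝ) (X : (x : M) → TangentSpace (𝓡 n) x →L[ℝ] ℝ),
    MemW p u X → SobolevInequality p q α A B u X

end RiemannianSobolev

end

/-!
Completeness and the Hopf–Rinow theorem make closed balls compact. In charts that distort lengths
by a factor close to `1`, convolution smooths the distance function without increasing its Lipschitz
constant much, and a partition of unity glues the results into a smooth proper function with bounded
gradient. Composing it with wide bumps yields compactly supported cutoffs whose gradients tend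
uniformly to `0`, so that it suffices to bound `φ ∈ C_c^∞(M)`.

Split such a `φ` at the height `t = τ ^ (-1 / p) * ‖φ‖_p`. The part above `t` is supported in
`{|φ| > t}`, a set of volume at most `τ` by Markov's inequality, so the hypothesis applies, and
its gradient is at most that of `φ`. The rest is bounded by a multiple of `t`, and interpolating
between `L^p` and `L^∞` bounds its `L^q` norm by a multiple of `‖φ‖_p`. Only `B` changes, because
`s ↦ s ^ α` is subadditive.
-/

noncomputable section

namespace RiemannianSobolev

open Set Metric MeasureTheory Filter Manifold

open scoped NNReal Convolution

section HopfRinow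

/-- Points that can be chosen, up to an arbitrarily small error, at any prescribed intermediate
distance between two given points: a form of the notion of length space that only involves
distances. -/
def HasApproxIntermediatePoints (X : Type*) [PseudoMetricSpace X] : Prop :=
  ∀ ⦃x y : X⦄ ⦃r s : ℝ⦄, 0 ≤ r → 0 < s → dist x y < r + s → ∃ z, dist x z ≤ r ∧ dist z y < s

namespace HasApproxIntermediatePoints

variable {X : Type*} [PseudoMetricSpace X] {x : X} {R : ℝ}

theorem closedBall_subset_thickening (hX : HasApproxIntermediatePoints X) {r s : ℝ} (hr : 0 ≤ r)
    (hs : 0 < s) (hR : R < r + s) : closedBall x R ⊆ thickening s (closedBall x r) := by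
  intro y hy
  obtain ⟨z, hxz, hzy⟩ := hX hr hs ((mem_closedBall'.1 hy).trans_lt hR)
  exact mem_thickening_iff.2 ⟨z, mem_closedBall'.2 hxz, by rwa [dist_comm]⟩

theorem isCompact_closedBall_of_forall_lt [CompleteSpace X] (hX : HasApproxIntermediatePoints X)
    (hR : 0 < R) (h : ∀ r < R, IsCompact (closedBall x r)) : IsCompact (closedBall x R) := by
  refine isCompact_iff_totallyBounded_isComplete.2 ⟨?_, isClosed_closedBall.isComplete⟩
  refine Metric.totallyBounded_iff.2 fun ε hε ↦ ?_
  obtain ⟨δ, hδ, hδlt⟩ := exists_between (lt_min (half_pos hε) hR)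
  rw [lt_min_iff] at hδlt
  obtain ⟨t, ht, hcover⟩ :=
    Metric.totallyBounded_iff.1 (h (R - δ) (by linarith)).totallyBounded (ε / 2) (half_pos hε)
  refine ⟨t, ht, fun y hy ↦ ?_⟩
  obtain ⟨z, hz, hyz⟩ := mem_thickening_iff.1 <|
    hX.closedBall_subset_thickening (r := R - δ) (s := ε / 2) (by linarith) (by linarith)
      (by linarith) hy
  obtain ⟨w, hw, hzw⟩ := mem_iUnion₂.1 (hcover hz)
  exact mem_iUnion₂.2 ⟨w, hw, (dist_triangle y z w).trans_lt (by linarith [mem_ball.1 hzw])⟩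

theorem exists_gt_isCompact_closedBall [WeaklyLocallyCompactSpace X]
    (hX : HasApproxIntermediatePoints X) (hR : 0 ≤ R) (h : IsCompact (closedBall x R)) :
    ∃ R' > R, IsCompact (closedBall x R') := by
  obtain ⟨K, hK, hsub⟩ := exists_compact_superset h
  obtain ⟨δ, hδ, hδK⟩ := h.exists_thickening_subset_open isOpen_interior hsub
  refine ⟨R + δ / 2, by linarith, hK.of_isClosed_subset isClosed_closedBall ?_⟩
  exact (hX.closedBall_subset_thickening hR hδ (by linarith)).trans (hδK.trans interior_subset)

theorem properSpace [CompleteSpace X] [WeaklyLocallyCompactSpace X]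
    (hX : HasApproxIntermediatePoints X) : ProperSpace X := by
  refine ⟨fun x r₀ ↦ ?_⟩
  by_contra hr₀
  have anti {r s : ℝ} (hrs : r ≤ s) (hs : IsCompact (closedBall x s)) :
      IsCompact (closedBall x r) :=
    hs.of_isClosed_subset isClosed_closedBall (closedBall_subset_closedBall hrs)
  let S : Set ℝ := {r | IsCompact (closedBall x r)}
  have hbdd : BddAbove S := ⟨r₀, fun r hr ↦ le_of_not_ge fun h ↦ hr₀ (anti h hr)⟩
  obtain ⟨r₁, hr₁, hr₁S⟩ := exists_isCompact_closedBall x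
  have hpos : 0 < sSup S := hr₁.trans_le (le_csSup hbdd hr₁S)
  have hsup : IsCompact (closedBall x (sSup S)) :=
    hX.isCompact_closedBall_of_forall_lt hpos fun r hr ↦
      let ⟨_, hs, hrs⟩ := exists_lt_of_lt_csSup ⟨r₁, hr₁S⟩ hr
      anti hrs.le hs
  obtain ⟨R', hR', hR'S⟩ := hX.exists_gt_isCompact_closedBall hpos.le hsup
  exact (le_csSup hbdd hR'S).not_gt hR'

end HasApproxIntermediatePoints

variable {E : Type*} [NormedAddCommGroup E] [NormedSpace ℝ E]
  {H : Type*} [TopologicalSpace H] (I : ModelWithCorners ℝ E H) (M : Type*)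

theorem hasApproxIntermediatePoints [PseudoMetricSpace M] [ChartedSpace H M]
    [Bundle.RiemannianBundle (fun x : M ↦ TangentSpace I x)] [IsRiemannianManifold I M] :
    HasApproxIntermediatePoints M := by
  intro x y r s hr hs hxy
  rcases le_or_gt (dist x y) r with hle | hlt
  · exact ⟨y, hle, by simpa⟩
  have hrs : 0 < r + s := add_pos_of_nonneg_of_pos hr hs
  obtain ⟨γ, hγ₀, hγ₁, hγ, hlen⟩ : ∃ γ : ℝ → M, γ 0 = x ∧ γ 1 = y ∧
      ContMDiffOn 𝓘(ℝ) I 1 γ (Icc 0 1) ∧ pathELength I γ 0 1 < ENNReal.ofReal (r + s) := by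
    refine exists_lt_of_riemannianEDist_lt ?_
    rwa [← IsRiemannianManifold.out, edist_dist, ENNReal.ofReal_lt_ofReal_iff hrs]
  have hdist : ContinuousOn (fun t ↦ dist x (γ t)) (Icc 0 1) :=
    continuous_dist.comp_continuousOn (continuousOn_const.prodMk hγ.continuousOn)
  obtain ⟨t, ht, rfl : dist x (γ t) = r⟩ : r ∈ (fun t ↦ dist x (γ t)) '' Icc 0 1 :=
    intermediate_value_Icc zero_le_one hdist ⟨by simpa [hγ₀], by simpa [hγ₁] using hlt.le⟩
  have hsplit : edist x (γ t) + edist (γ t) y < ENNReal.ofReal (dist x (γ t) + s) := by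
    refine lt_of_le_of_lt ?_ hlen
    simp only [IsRiemannianManifold.out (I := I)]
    rw [← pathELength_add ht.1 ht.2]
    exact add_le_add
      (riemannianEDist_le_pathELength (hγ.mono (Icc_subset_Icc_right ht.2)) hγ₀ rfl ht.1)
      (riemannianEDist_le_pathELength (hγ.mono (Icc_subset_Icc_left ht.1)) rfl hγ₁ ht.2)
  rw [edist_dist, edist_dist, ← ENNReal.ofReal_add dist_nonneg dist_nonneg,
    ENNReal.ofReal_lt_ofReal_iff hrs] at hsplit
  exact ⟨γ t, le_rfl, lt_of_add_lt_add_left hsplit⟩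

end HopfRinow

section MeanValue

variable {E : Type*} [NormedAddCommGroup E] [NormedSpace ℝ E]
  {H : Type*} [TopologicalSpace H] {I : ModelWithCorners ℝ E H}
  {M : Type*} [PseudoEMetricSpace M] [ChartedSpace H M]
  [Bundle.RiemannianBundle (fun x : M ↦ TangentSpace I x)] [IsRiemannianManifold I M]
  {F : Type*} [NormedAddCommGroup F] [NormedSpace ℝ F]

theorem lipschitzOnWith_of_enorm_mfderivWithin_le {Ψ : F → M} {s : Set F} (hs : Convex ℝ s)
    (hΨ : ContMDiffOn 𝓘(ℝ, F) I 1 Ψ s) {C : ℝ≥0}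
    (hC : ∀ v ∈ s, ∀ w : F, ‖mfderivWithin 𝓘(ℝ, F) I Ψ s v w‖ₑ ≤ C * ‖w‖ₑ) :
    LipschitzOnWith C Ψ s := by
  intro v hv w hw
  let η : ℝ → F := ContinuousAffineMap.lineMap (R := ℝ) v w
  have hη (t : ℝ) : HasDerivAt η (w - v) t := AffineMap.hasDerivAt_lineMap
  have hηs : MapsTo η (Icc 0 1) s := fun t ht ↦ hs.lineMap_mem hv hw ht
  have hηsmooth : ContMDiffOn 𝓘(ℝ) 𝓘(ℝ, F) 1 η (Icc 0 1) :=
    (contMDiff_iff_contDiff.2 (ContinuousAffineMap.contDiff _)).contMDiffOn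
  have hspeed : ∀ t ∈ Icc (0 : ℝ) 1,
      ‖mfderivWithin 𝓘(ℝ) I (Ψ ∘ η) (Icc 0 1) t 1‖ₑ ≤ C * edist v w := by
    intro t ht
    have hunique : UniqueMDiffWithinAt 𝓘(ℝ) (Icc (0 : ℝ) 1) t :=
      (uniqueDiffOn_Icc_zero_one t ht).uniqueMDiffWithinAt
    have hderiv : HasMFDerivWithinAt 𝓘(ℝ) I (Ψ ∘ η) (Icc 0 1) t _ :=
      HasMFDerivWithinAt.comp t
        ((hΨ.mdifferentiableOn one_ne_zero _ (hηs ht)).hasMFDerivWithinAt)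
        (hη t).hasFDerivAt.hasFDerivWithinAt.hasMFDerivWithinAt hηs
    rw [hderiv.mfderivWithin hunique, edist_comm, edist_eq_enorm_sub]
    refine le_trans (le_of_eq ?_) (hC _ (hηs ht) (w - v))
    change ‖mfderivWithin 𝓘(ℝ, F) I Ψ s (η t) ((1 : ℝ) • (w - v))‖ₑ = _
    rw [one_smul]
  calc edist (Ψ v) (Ψ w) ≤ pathELength I (Ψ ∘ η) 0 1 := by
        rw [IsRiemannianManifold.out (I := I)]
        exact riemannianEDist_le_pathELength (hΨ.comp hηsmooth hηs)
          (by simp [η, ContinuousAffineMap.coe_lineMap_eq])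
          (by simp [η, ContinuousAffineMap.coe_lineMap_eq]) zero_le_one
    _ = ∫⁻ t in Icc (0 : ℝ) 1, ‖mfderivWithin 𝓘(ℝ) I (Ψ ∘ η) (Icc 0 1) t 1‖ₑ :=
        pathELength_eq_lintegral_mfderivWithin_Icc
    _ ≤ ∫⁻ _ in Icc (0 : ℝ) 1, C * edist v w := setLIntegral_mono' measurableSet_Icc hspeed
    _ = C * edist v w := by simp

end MeanValue

section Mollification

variable {F : Type*} [NormedAddCommGroup F] [NormedSpace ℝ F] [FiniteDimensional ℝ F]
  {G : Type*} [NormedAddCommGroup G] [NormedSpace ℝ G] {g : F → G} {C : ℝ≥0}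

theorem lipschitzWith_normed_convolution [MeasurableSpace F] [BorelSpace F] {μ : Measure F}
    [μ.IsAddHaarMeasure] (φ : ContDiffBump (0 : F)) (hg : LipschitzWith C g) :
    LipschitzWith C (φ.normed μ ⋆[ContinuousLinearMap.lsmul ℝ ℝ, μ] g) := by
  have hint (v : F) : Integrable (fun t ↦ φ.normed μ t • g (v - t)) μ :=
    (φ.continuous_normed.smul
      (hg.continuous.comp (continuous_const.sub continuous_id))).integrable_of_hasCompactSupport
      φ.hasCompactSupport_normed.smul_right
  refine LipschitzWith.of_dist_le_mul fun v w ↦ ?_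
  calc dist ((φ.normed μ ⋆[ContinuousLinearMap.lsmul ℝ ℝ, μ] g) v)
        ((φ.normed μ ⋆[ContinuousLinearMap.lsmul ℝ ℝ, μ] g) w)
      = ‖∫ t, φ.normed μ t • (g (v - t) - g (w - t)) ∂μ‖ := by
        simp only [dist_eq_norm, convolution_def, ContinuousLinearMap.lsmul_apply, smul_sub]
        rw [integral_sub (hint v) (hint w)]
    _ ≤ ∫ t, φ.normed μ t * (C * dist v w) ∂μ := by
        refine norm_integral_le_of_norm_le (φ.integrable_normed.mul_const _)
          (ae_of_all _ fun t ↦ ?_)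
        rw [norm_smul, Real.norm_of_nonneg (φ.nonneg_normed t), ← dist_eq_norm,
          ← dist_sub_right v w t]
        exact mul_le_mul_of_nonneg_left (hg.dist_le_mul _ _) (φ.nonneg_normed t)
    _ = C * dist v w := by rw [integral_mul_const, φ.integral_normed, one_mul]

theorem exists_contDiff_dist_le_norm_fderiv_le [CompleteSpace G] (hg : LipschitzWith C g) {δ : ℝ}
    (hδ : 0 < δ) :
    ∃ f : F → G, ContDiff ℝ ∞ f ∧ (∀ v, dist (f v) (g v) ≤ δ) ∧ ∀ v, ‖fderiv ℝ f v‖ ≤ C := by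
  borelize F
  let μ : Measure F := Measure.addHaar
  obtain ⟨r, hr, hCr⟩ : ∃ r > 0, C * r ≤ δ :=
    ⟨δ / (C + 1), by positivity, by
      rw [mul_div_assoc', div_le_iff₀ (by positivity), mul_comm]; gcongr; linarith⟩
  let φ : ContDiffBump (0 : F) := ⟨r / 2, r, half_pos hr, half_lt_self hr⟩
  refine ⟨φ.normed μ ⋆[ContinuousLinearMap.lsmul ℝ ℝ, μ] g, ?_, fun v ↦ ?_, fun v ↦ ?_⟩
  · exact φ.hasCompactSupport_normed.contDiff_convolution_left _ φ.contDiff_normed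
      hg.continuous.locallyIntegrable
  · refine φ.dist_normed_convolution_le hg.continuous.aestronglyMeasurable fun w hw ↦ ?_
    exact (hg.dist_le_mul w v).trans (hCr.trans' (by gcongr; exact (mem_ball.1 hw).le))
  · exact norm_fderiv_le_of_lipschitz ℝ (lipschitzWith_normed_convolution φ hg)

end Mollification

section NearIsometricCharts

variable {E : Type*} [NormedAddCommGroup E] [NormedSpace ℝ E]
  {M : Type*} [MetricSpace M] [ChartedSpace E M] [IsManifold 𝓘(ℝ, E) ∞ M]
  {F : Type*} [NormedAddCommGroup F] [NormedSpace ℝ F]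

variable (E) in
/-- The differential at `x` of the preferred chart at `x`, as an isomorphism. -/
def chartFrame (x : M) : TangentSpace 𝓘(ℝ, E) x ≃L[ℝ] E :=
  (trivializationAt E (TangentSpace 𝓘(ℝ, E)) x).continuousLinearEquivAt ℝ x
    (FiberBundle.mem_baseSet_trivializationAt' x)

theorem chartFrame_apply (x : M) (v : TangentSpace 𝓘(ℝ, E) x) :
    chartFrame E x v =
      (trivializationAt E (TangentSpace 𝓘(ℝ, E)) x).continuousLinearMapAt ℝ x v :=
  congrFun (Bundle.Trivialization.coe_continuousLinearEquivAt_eq _ _) v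

theorem chartFrame_symm_apply (x : M) (w : E) :
    (chartFrame E x).symm w = (trivializationAt E (TangentSpace 𝓘(ℝ, E)) x).symmL ℝ x w :=
  congrFun (Bundle.Trivialization.symm_continuousLinearEquivAt_eq _ _) w

variable [Bundle.RiemannianBundle (fun x : M ↦ TangentSpace 𝓘(ℝ, E) x)]

section

variable [IsContinuousRiemannianBundle E (fun x : M ↦ TangentSpace 𝓘(ℝ, E) x)] {K : ℝ≥0}

theorem eventually_norm_chartFrame_symm_mfderiv_extChartAt_le (x : M) (hK : 1 < K) :
    ∀ᶠ y in 𝓝 x, ∀ w : TangentSpace 𝓘(ℝ, E) y,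
      ‖(chartFrame E x).symm (mfderiv 𝓘(ℝ, E) 𝓘(ℝ, E) (extChartAt 𝓘(ℝ, E) x) y w)‖ ≤ K * ‖w‖ := by
  filter_upwards [eventually_norm_symmL_trivializationAt_self_comp_lt E
    (fun x : M ↦ TangentSpace 𝓘(ℝ, E) x) x (NNReal.one_lt_coe.2 hK),
    chart_source_mem_nhds E x] with y hy hys w
  have hle := ContinuousLinearMap.le_of_opNorm_le _ hy.le w
  rwa [ContinuousLinearMap.comp_apply, ← chartFrame_symm_apply,
    TangentBundle.continuousLinearMapAt_trivializationAt hys] at hle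

theorem exists_eventually_norm_mfderiv_extChartAt_le (x : M) :
    ∃ c > 0, ∀ᶠ y in 𝓝 x, ∀ w : TangentSpace 𝓘(ℝ, E) y,
      ‖mvfderiv 𝓘(ℝ, E) (extChartAt 𝓘(ℝ, E) x) y w‖ ≤ c * ‖w‖ := by
  have : IsManifold 𝓘(ℝ, E) 1 M := .of_le (n := ∞) (by simp)
  obtain ⟨c, hc, hcx⟩ := eventually_norm_mfderiv_extChartAt_lt 𝓘(ℝ, E) x
  let _ := fun e : E ↦ normedAddCommGroupTangentSpaceVectorSpace e
  let _ := fun e : E ↦ normedSpaceTangentSpaceVectorSpace e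
  exact ⟨c, hc, hcx.mono fun y hy w ↦ ContinuousLinearMap.le_of_opNorm_le _ hy.le w⟩

theorem eventually_norm_mfderiv_extChartAt_symm_chartFrame_le (x : M) (hK : 1 < K) :
    ∀ᶠ e in 𝓝 (extChartAt 𝓘(ℝ, E) x x), ∀ v : TangentSpace 𝓘(ℝ, E) x,
      ‖mfderiv 𝓘(ℝ, E) 𝓘(ℝ, E) (extChartAt 𝓘(ℝ, E) x).symm e (chartFrame E x v)‖ ≤ K * ‖v‖ := by
  have hsymm : Tendsto (extChartAt 𝓘(ℝ, E) x).symm (𝓝 (extChartAt 𝓘(ℝ, E) x x)) (𝓝 x) :=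
    map_extChartAt_symm_nhdsWithin_range (I := 𝓘(ℝ, E)) x ▸ by simp [Tendsto]
  filter_upwards [hsymm.eventually (eventually_norm_symmL_trivializationAt_comp_self_lt E
      (fun x : M ↦ TangentSpace 𝓘(ℝ, E) x) x (NNReal.one_lt_coe.2 hK)),
    hsymm.eventually (chart_source_mem_nhds E x),
    extChartAt_target_mem_nhds (I := 𝓘(ℝ, E)) x] with e he hes het v
  have hle := ContinuousLinearMap.le_of_opNorm_le _ he.le v
  rw [ContinuousLinearMap.comp_apply, ← chartFrame_apply,
    TangentBundle.symmL_trivializationAt hes, (extChartAt 𝓘(ℝ, E) x).right_inv het] at hle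
  simp only [modelWithCornersSelf_coe, range_id, mfderivWithin_univ] at hle
  exact hle

end

variable (E) in
/-- A smooth chart `Φ : U → F`, with inverse `Ψ`, that multiplies lengths by at most `K`, and whose
inverse multiplies distances by at most `K`. -/
structure IsNearIsometricChart (K : ℝ≥0) (U : Set M) (Φ : M → F) (Ψ : F → M) : Prop where
  isOpen : IsOpen U
  contMDiffOn : ContMDiffOn 𝓘(ℝ, E) 𝓘(ℝ, F) ∞ Φ U
  norm_mfderiv_le : ∀ y ∈ U, ∀ w : TangentSpace 𝓘(ℝ, E) y,
    ‖mvfderiv 𝓘(ℝ, E) Φ y w‖ ≤ K * ‖w‖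
  lipschitzOnWith : LipschitzOnWith K Ψ (Φ '' U)
  leftInvOn : LeftInvOn Ψ Φ U

theorem lipschitzOnWith_extChartAt_symm_comp [IsRiemannianManifold 𝓘(ℝ, E) M] {x : M}
    {L : F ≃L[ℝ] E} {s : Set F} {K : ℝ≥0} (hs : Convex ℝ s) (hso : IsOpen s)
    (ht : MapsTo L s (extChartAt 𝓘(ℝ, E) x).target)
    (hK : ∀ v ∈ s, ∀ w : F,
      ‖mfderiv 𝓘(ℝ, E) 𝓘(ℝ, E) (extChartAt 𝓘(ℝ, E) x).symm (L v) (L w)‖ ≤ K * ‖w‖) :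
    LipschitzOnWith K ((extChartAt 𝓘(ℝ, E) x).symm ∘ L) s := by
  have hLsmooth : ContMDiff 𝓘(ℝ, F) 𝓘(ℝ, E) 1 L := L.contDiff.contMDiff
  refine lipschitzOnWith_of_enorm_mfderivWithin_le (I := 𝓘(ℝ, E)) hs
    (((contMDiffOn_extChartAt_symm (n := ∞) x).of_le (by simp)).comp hLsmooth.contMDiffOn ht)
    fun v hv w ↦ ?_
  have hsymm : MDifferentiableAt 𝓘(ℝ, E) 𝓘(ℝ, E) (extChartAt 𝓘(ℝ, E) x).symm (L v) := by
    simpa [mdifferentiableWithinAt_univ] using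
      mdifferentiableWithinAt_extChartAt_symm (I := 𝓘(ℝ, E)) (ht hv)
  have hcomp : HasMFDerivAt 𝓘(ℝ, F) 𝓘(ℝ, E) ((extChartAt 𝓘(ℝ, E) x).symm ∘ L) v _ :=
    HasMFDerivAt.comp v hsymm.hasMFDerivAt L.hasFDerivAt.hasMFDerivAt
  rw [mfderivWithin_of_isOpen hso hv, hcomp.mfderiv, ← ofReal_norm, ← ofReal_norm,
    ← ENNReal.ofReal_coe_nnreal, ← ENNReal.ofReal_mul K.coe_nonneg]
  exact ENNReal.ofReal_le_ofReal (hK v hv w)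

theorem exists_isNearIsometricChart_of_eventually_norm_le [IsRiemannianManifold 𝓘(ℝ, E) M]
    (x : M) (L : F ≃L[ℝ] E) {K : ℝ≥0}
    (hΦ : ∀ᶠ y in 𝓝 x, ∀ w : TangentSpace 𝓘(ℝ, E) y,
      ‖L.symm (mfderiv 𝓘(ℝ, E) 𝓘(ℝ, E) (extChartAt 𝓘(ℝ, E) x) y w)‖ ≤ K * ‖w‖)
    (hΨ : ∀ᶠ e in 𝓝 (extChartAt 𝓘(ℝ, E) x x), ∀ v : F,
      ‖mfderiv 𝓘(ℝ, E) 𝓘(ℝ, E) (extChartAt 𝓘(ℝ, E) x).symm e (L v)‖ ≤ K * ‖v‖) :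
    ∃ (U : Set M) (Φ : M → F) (Ψ : F → M), x ∈ U ∧ IsNearIsometricChart E K U Φ Ψ := by
  let c : F := L.symm (extChartAt 𝓘(ℝ, E) x x)
  have hLc : Tendsto L (𝓝 c) (𝓝 (extChartAt 𝓘(ℝ, E) x x)) := by
    simpa [c] using L.continuous.tendsto c
  obtain ⟨r, hr, hball⟩ := Metric.mem_nhds_iff.1
    (hLc.eventually (hΨ.and (extChartAt_target_mem_nhds (I := 𝓘(ℝ, E)) x)))
  have hΦball : ∀ᶠ y in 𝓝 x, L.symm (extChartAt 𝓘(ℝ, E) x y) ∈ ball c r :=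
    (L.symm.continuous.continuousAt.comp
      (continuousAt_extChartAt (I := 𝓘(ℝ, E)) x)).eventually_mem (ball_mem_nhds _ hr)
  obtain ⟨U, hU, hUo, hxU⟩ := _root_.mem_nhds_iff.1
    ((hΦ.and hΦball).and (chart_source_mem_nhds E x))
  refine ⟨U, L.symm ∘ extChartAt 𝓘(ℝ, E) x, (extChartAt 𝓘(ℝ, E) x).symm ∘ L, hxU, hUo, ?_,
    fun y hy w ↦ ?_, ?_, fun y hy ↦ ?_⟩
  · exact L.symm.contDiff.contMDiff.comp_contMDiffOn
      ((contMDiffOn_extChartAt (n := ∞)).mono fun y hy ↦ (hU hy).2)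
  · have hcomp : HasMFDerivAt 𝓘(ℝ, E) 𝓘(ℝ, F) (L.symm ∘ extChartAt 𝓘(ℝ, E) x) y _ :=
      HasMFDerivAt.comp y L.symm.hasFDerivAt.hasMFDerivAt
        (mdifferentiableAt_extChartAt (I := 𝓘(ℝ, E)) (hU hy).2).hasMFDerivAt
    simp only [mvfderiv, hcomp.mfderiv]
    exact (hU hy).1.1 w
  · refine (lipschitzOnWith_extChartAt_symm_comp (convex_ball c r) isOpen_ball
      (fun v hv ↦ (hball hv).2) fun v hv ↦ (hball hv).1).mono ?_
    exact image_subset_iff.2 fun y hy ↦ (hU hy).1.2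
  · simpa using (chartAt E x).left_inv (hU hy).2

theorem exists_isNearIsometricChart [IsRiemannianManifold 𝓘(ℝ, E) M]
    [IsContinuousRiemannianBundle E (fun x : M ↦ TangentSpace 𝓘(ℝ, E) x)] (x : M) {K : ℝ≥0}
    (hK : 1 < K) :
    ∃ (U : Set M) (Φ : M → TangentSpace 𝓘(ℝ, E) x) (Ψ : TangentSpace 𝓘(ℝ, E) x → M),
      x ∈ U ∧ IsNearIsometricChart E K U Φ Ψ :=
  exists_isNearIsometricChart_of_eventually_norm_le x (chartFrame E x)
    (eventually_norm_chartFrame_symm_mfderiv_extChartAt_le x hK)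
    (eventually_norm_mfderiv_extChartAt_symm_chartFrame_le x hK)

end NearIsometricCharts

section Differential

variable {n : ℕ} {M : Type*} [MetricSpace M] [ChartedSpace (EuclideanSpace ℝ (Fin n)) M]
  {φ ψ : M → ℝ} {y : M}

theorem differential_congr (h : φ =ᶠ[𝓝 y] ψ) :
    differential (n := n) φ y = differential ψ y :=
  h.mfderiv_eq

theorem differential_const (c : ℝ) (y : M) : differential (n := n) (fun _ : M ↦ c) y = 0 :=
  mfderiv_const

theorem differential_eq_zero_of_notMem_tsupport (h : y ∉ tsupport φ) :
    differential (n := n) φ y = 0 := by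
  rw [differential_congr (notMem_tsupport_iff_eventuallyEq.1 h)]
  exact differential_const 0 y

theorem differential_mul (hφ : MDifferentiableAt (𝓡 n) 𝓘(ℝ, ℝ) φ y)
    (hψ : MDifferentiableAt (𝓡 n) 𝓘(ℝ, ℝ) ψ y) :
    differential (n := n) (φ * ψ) y = φ y • differential ψ y + ψ y • differential φ y :=
  (HasMFDerivAt.mul hφ.hasMFDerivAt hψ.hasMFDerivAt).mfderiv

theorem differential_comp {g : ℝ → ℝ} (hg : DifferentiableAt ℝ g (φ y))
    (hφ : MDifferentiableAt (𝓡 n) 𝓘(ℝ, ℝ) φ y) :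
    differential (n := n) (g ∘ φ) y = deriv g (φ y) • differential φ y := by
  have hcomp : HasMFDerivAt (𝓡 n) 𝓘(ℝ, ℝ) (g ∘ φ) y _ :=
    HasMFDerivAt.comp y hg.hasFDerivAt.hasMFDerivAt hφ.hasMFDerivAt
  refine hcomp.mfderiv.trans (ContinuousLinearMap.ext fun w ↦ ?_)
  exact fderiv_eq_deriv_mul (x := φ y) (y := differential φ y w)

theorem hasMFDerivAt_sum {ι : Type*} {s : Finset ι} {φ : ι → M → ℝ}
    {φ' : ι → TangentSpace (𝓡 n) y →L[ℝ] ℝ}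
    (hφ : ∀ i ∈ s, HasMFDerivAt (𝓡 n) 𝓘(ℝ, ℝ) (φ i) y (φ' i)) :
    HasMFDerivAt (𝓡 n) 𝓘(ℝ, ℝ) (∑ i ∈ s, φ i) y (∑ i ∈ s, φ' i) := by
  classical
  induction s using Finset.induction_on with
  | empty => exact hasMFDerivAt_const (0 : ℝ) y
  | insert i s hi ih =>
    have hadd := (hφ i (Finset.mem_insert_self i s)).add
      (ih fun j hj ↦ hφ j (Finset.mem_insert_of_mem hj))
    rw [← Finset.sum_insert hi] at hadd
    have hsum : ∑ j ∈ insert i s, φ' j = φ' i + ∑ j ∈ s, φ' j := Finset.sum_insert hi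
    exact hsum ▸ hadd

theorem differential_sum {ι : Type*} {s : Finset ι} {φ : ι → M → ℝ}
    (hφ : ∀ i ∈ s, MDifferentiableAt (𝓡 n) 𝓘(ℝ, ℝ) (φ i) y) :
    differential (n := n) (∑ i ∈ s, φ i) y = ∑ i ∈ s, differential (φ i) y :=
  (hasMFDerivAt_sum fun i hi ↦ (hφ i hi).hasMFDerivAt).mfderiv

theorem differential_eq_fderiv_comp_extChartAt_symm [IsManifold (𝓡 n) ∞ M] {x : M}
    (hφ : ContMDiff (𝓡 n) 𝓘(ℝ, ℝ) 1 φ) (hy : y ∈ (extChartAt (𝓡 n) x).source)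
    (w : TangentSpace (𝓡 n) y) :
    differential (n := n) φ y w = fderiv ℝ (φ ∘ (extChartAt (𝓡 n) x).symm) (extChartAt (𝓡 n) x y)
      (mvfderiv (𝓡 n) (extChartAt (𝓡 n) x) y w) := by
  have hcoord : ContDiffAt ℝ 1 (φ ∘ (extChartAt (𝓡 n) x).symm) (extChartAt (𝓡 n) x y) :=
    (contMDiffOn_iff_contDiffOn.1 (hφ.comp_contMDiffOn (contMDiffOn_extChartAt_symm x))).contDiffAt
      (extChartAt_target_mem_nhds' ((extChartAt (𝓡 n) x).map_source hy))
  have hchart : MDifferentiableAt (𝓡 n) (𝓡 n) (extChartAt (𝓡 n) x) y :=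
    mdifferentiableAt_extChartAt (by rwa [extChartAt_source] at hy)
  have hcomp : HasMFDerivAt (𝓡 n) 𝓘(ℝ, ℝ) _ y _ := HasMFDerivAt.comp y
    (hcoord.differentiableAt (by simp)).hasFDerivAt.hasMFDerivAt hchart.hasMFDerivAt
  have heq : φ =ᶠ[𝓝 y] (φ ∘ (extChartAt (𝓡 n) x).symm) ∘ extChartAt (𝓡 n) x := by
    filter_upwards [extChartAt_source_mem_nhds' hy] with z hz
    simp only [Function.comp_apply, (extChartAt (𝓡 n) x).left_inv hz]
  rw [differential_congr heq, differential, hcomp.mfderiv]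
  rfl

variable [Bundle.RiemannianBundle (fun x : M ↦ TangentSpace (𝓡 n) x)]

theorem covectorNorm_zero : covectorNorm (0 : TangentSpace (𝓡 n) y →L[ℝ] ℝ) = 0 :=
  ContinuousLinearMap.opNorm_zero

theorem covectorNorm_nonneg (ξ : TangentSpace (𝓡 n) y →L[ℝ] ℝ) : 0 ≤ covectorNorm ξ :=
  norm_nonneg ξ

theorem covectorNorm_add_le (ξ η : TangentSpace (𝓡 n) y →L[ℝ] ℝ) :
    covectorNorm (ξ + η) ≤ covectorNorm ξ + covectorNorm η :=
  norm_add_le ξ η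

theorem abs_covectorNorm_sub_le (ξ η : TangentSpace (𝓡 n) y →L[ℝ] ℝ) :
    |covectorNorm ξ - covectorNorm η| ≤ covectorNorm (ξ - η) :=
  abs_norm_sub_norm_le ξ η

theorem covectorNorm_smul_le (c : ℝ) (ξ : TangentSpace (𝓡 n) y →L[ℝ] ℝ) :
    covectorNorm (c • ξ) ≤ |c| * covectorNorm ξ :=
  ContinuousLinearMap.opNorm_smul_le c ξ

theorem covectorNorm_sum_le {ι : Type*} (s : Finset ι) (ξ : ι → TangentSpace (𝓡 n) y →L[ℝ] ℝ) :
    covectorNorm (∑ i ∈ s, ξ i) ≤ ∑ i ∈ s, covectorNorm (ξ i) :=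
  norm_sum_le s ξ

end Differential

section SmoothApproximation

variable {n : ℕ} {M : Type*} [MetricSpace M] [ChartedSpace (EuclideanSpace ℝ (Fin n)) M]
  [Bundle.RiemannianBundle (fun x : M ↦ TangentSpace (𝓡 n) x)]
  {f : M → ℝ} {C : ℝ≥0}

theorem IsNearIsometricChart.exists_contMDiffOn_approx {F : Type*} [NormedAddCommGroup F]
    [NormedSpace ℝ F] [FiniteDimensional ℝ F] {K : ℝ≥0} {U : Set M} {Φ : M → F} {Ψ : F → M}
    (hΦ : IsNearIsometricChart (EuclideanSpace ℝ (Fin n)) K U Φ Ψ) (hf : LipschitzWith C f) {δ : ℝ}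
    (hδ : 0 < δ) :
    ∃ h : M → ℝ, ContMDiffOn (𝓡 n) 𝓘(ℝ, ℝ) ∞ h U ∧ (∀ y ∈ U, |h y - f y| ≤ δ) ∧
      ∀ y ∈ U, covectorNorm (differential (n := n) h y) ≤ C * K * K := by
  obtain ⟨g, hg, hfg⟩ := (hf.comp_lipschitzOnWith hΦ.lipschitzOnWith).extend_real
  obtain ⟨G, hG, hGg, hG'⟩ := exists_contDiff_dist_le_norm_fderiv_le hg hδ
  refine ⟨G ∘ Φ, hG.contMDiff.comp_contMDiffOn hΦ.contMDiffOn, fun y hy ↦ ?_, fun y hy ↦ ?_⟩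
  · have hgy : g (Φ y) = f y := by
      rw [← hfg (mem_image_of_mem Φ hy), Function.comp_apply, hΦ.leftInvOn hy]
    exact hgy ▸ hGg (Φ y)
  · have hΦy : MDifferentiableAt (𝓡 n) 𝓘(ℝ, F) Φ y :=
      (hΦ.contMDiffOn.contMDiffAt (hΦ.isOpen.mem_nhds hy)).mdifferentiableAt (by simp)
    have hcomp : HasMFDerivAt (𝓡 n) 𝓘(ℝ, ℝ) (G ∘ Φ) y _ :=
      HasMFDerivAt.comp y (hG.differentiable (by simp) (Φ y)).hasFDerivAt.hasMFDerivAt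
        hΦy.hasMFDerivAt
    refine ContinuousLinearMap.opNorm_le_bound _ (by positivity) fun w ↦ ?_
    rw [differential, hcomp.mfderiv]
    calc ‖fderiv ℝ G (Φ y) (mvfderiv (𝓡 n) Φ y w)‖
        ≤ (C * K : ℝ≥0) * ‖mvfderiv (𝓡 n) Φ y w‖ :=
          ContinuousLinearMap.le_of_opNorm_le _ (hG' _) _
      _ ≤ (C * K : ℝ≥0) * (K * ‖w‖) := by gcongr; exact hΦ.norm_mfderiv_le y hy w
      _ = C * K * K * ‖w‖ := by push_cast; ring

variable [IsManifold (𝓡 n) ∞ M]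

theorem exists_nhds_contMDiffOn_approx [IsRiemannianManifold (𝓡 n) M]
    [IsContinuousRiemannianBundle (EuclideanSpace ℝ (Fin n)) (fun x : M ↦ TangentSpace (𝓡 n) x)]
    (hf : LipschitzWith C f) {C' : ℝ≥0} (hC : C < C') (x : M) :
    ∃ U : Set M, IsOpen U ∧ x ∈ U ∧ ∀ δ > 0, ∃ h : M → ℝ, ContMDiffOn (𝓡 n) 𝓘(ℝ, ℝ) ∞ h U ∧
      (∀ y ∈ U, |h y - f y| ≤ δ) ∧ ∀ y ∈ U, covectorNorm (differential (n := n) h y) ≤ C' := by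
  obtain ⟨K, hK1, hK⟩ : ∃ K : ℝ≥0, 1 < K ∧ C * K * K < C' := by
    have hlim : Tendsto (fun K : ℝ≥0 ↦ C * K * K) (𝓝[>] 1) (𝓝 C) := by
      refine (Continuous.tendsto' (by fun_prop) 1 C (by simp)).mono_left nhdsWithin_le_nhds
    exact (eventually_mem_nhdsWithin.and (hlim.eventually_lt_const hC)).exists
  obtain ⟨U, Φ, Ψ, hxU, hΦ⟩ :=
    exists_isNearIsometricChart (E := EuclideanSpace ℝ (Fin n)) x hK1
  have : FiniteDimensional ℝ (TangentSpace (𝓡 n) x) :=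
    inferInstanceAs (FiniteDimensional ℝ (EuclideanSpace ℝ (Fin n)))
  refine ⟨U, hΦ.isOpen, hxU, fun δ hδ ↦ ?_⟩
  obtain ⟨h, hh, hhf, hdh⟩ := hΦ.exists_contMDiffOn_approx hf hδ
  exact ⟨h, hh, hhf, fun y hy ↦ (hdh y hy).trans (mod_cast hK.le)⟩

variable [IsContinuousRiemannianBundle (EuclideanSpace ℝ (Fin n))
  (fun x : M ↦ TangentSpace (𝓡 n) x)]

theorem exists_eventually_covectorNorm_differential_le {φ : M → ℝ}
    (hφ : ContMDiff (𝓡 n) 𝓘(ℝ, ℝ) 1 φ) (x : M) :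
    ∃ B, ∀ᶠ y in 𝓝 x, covectorNorm (differential (n := n) φ y) ≤ B := by
  let φ' := fderiv ℝ (φ ∘ (extChartAt (𝓡 n) x).symm)
  have hφ' : ContinuousAt (fun y ↦ ‖φ' (extChartAt (𝓡 n) x y)‖) x := by
    have hcoord : ContDiffAt ℝ 1 (φ ∘ (extChartAt (𝓡 n) x).symm) (extChartAt (𝓡 n) x x) :=
      (contMDiffOn_iff_contDiffOn.1
        (hφ.comp_contMDiffOn (contMDiffOn_extChartAt_symm x))).contDiffAt
        (extChartAt_target_mem_nhds x)
    exact ((hcoord.continuousAt_fderiv (by simp)).comp (continuousAt_extChartAt x)).norm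
  obtain ⟨c, hc, hcx⟩ :=
    exists_eventually_norm_mfderiv_extChartAt_le (E := EuclideanSpace ℝ (Fin n)) x
  refine ⟨(‖φ' (extChartAt (𝓡 n) x x)‖ + 1) * c, ?_⟩
  filter_upwards [hcx, extChartAt_source_mem_nhds (I := 𝓡 n) x,
    hφ'.eventually_lt_const (lt_add_one _)] with y hcy hy hφy
  refine ContinuousLinearMap.opNorm_le_bound _ (by positivity) fun w ↦ ?_
  rw [differential_eq_fderiv_comp_extChartAt_symm hφ hy, mul_assoc]
  exact (φ' _).le_of_opNorm_le_of_le hφy.le (hcy w)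

theorem exists_covectorNorm_differential_le {φ : M → ℝ} (hφ : ContMDiff (𝓡 n) 𝓘(ℝ, ℝ) 1 φ)
    (hc : HasCompactSupport φ) : ∃ B, ∀ y, covectorNorm (differential (n := n) φ y) ≤ B := by
  choose B hB using exists_eventually_covectorNorm_differential_le hφ
  obtain ⟨t, -, ht⟩ := hc.isCompact.elim_nhds_subcover _ fun x _ ↦ hB x
  obtain ⟨D, hD⟩ := (insert 0 (t.image B)).exists_le
  refine ⟨D, fun y ↦ ?_⟩
  by_cases hy : y ∈ tsupport φ
  · obtain ⟨x, hx, hxy⟩ := mem_iUnion₂.1 (ht hy)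
    exact LE.le.trans hxy (hD _ (Finset.mem_insert_of_mem (Finset.mem_image_of_mem B hx)))
  · rw [differential_eq_zero_of_notMem_tsupport hy, covectorNorm_zero]
    exact hD 0 (by simp)

end SmoothApproximation

section Gluing

variable {n : ℕ} {M : Type*} [MetricSpace M] [ChartedSpace (EuclideanSpace ℝ (Fin n)) M]
  {ι : Type*} (ρ : SmoothPartitionOfUnity ι (𝓡 n) M univ) {y : M}

theorem finsum_smul_eventuallyEq_sum_fintsupport (g : ι → M → ℝ) (y : M) :
    (fun z ↦ ∑ᶠ i, ρ i z • g i z) =ᶠ[𝓝 y] ∑ i ∈ ρ.fintsupport y, ⇑(ρ i) * g i := by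
  filter_upwards [ρ.eventually_finsupport_subset y] with z hz
  rw [← ρ.sum_finsupport_smul_eq_finsum, Finset.sum_apply]
  refine Finset.sum_subset hz fun i _ hi ↦ ?_
  rw [ρ.mem_finsupport, Function.notMem_support] at hi
  rw [hi, zero_smul]

theorem sum_fintsupport_differential_eq_zero (y : M) :
    ∑ i ∈ ρ.fintsupport y, differential (n := n) (ρ i) y = 0 := by
  rw [← differential_sum fun i _ ↦ (ρ i).contMDiff.mdifferentiableAt (by simp),
    ← differential_const (1 : ℝ) y]
  refine differential_congr ?_
  filter_upwards [ρ.eventually_finsupport_subset y] with z hz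
  rw [Finset.sum_apply, ρ.sum_finsupport' z (mem_univ z) hz]

theorem differential_finsum_smul {g : ι → M → ℝ}
    (hg : ∀ i, y ∈ tsupport (ρ i) → MDifferentiableAt (𝓡 n) 𝓘(ℝ, ℝ) (g i) y) (c : ℝ) :
    differential (n := n) (fun z ↦ ∑ᶠ i, ρ i z • g i z) y = ∑ i ∈ ρ.fintsupport y,
      (ρ i y • differential (g i) y + (g i y - c) • differential (ρ i) y) := by
  have hρ : ∀ i, MDifferentiableAt (𝓡 n) 𝓘(ℝ, ℝ) (ρ i) y := fun i ↦
    (ρ i).contMDiff.mdifferentiableAt (by simp)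
  have hgy : ∀ i ∈ ρ.fintsupport y, MDifferentiableAt (𝓡 n) 𝓘(ℝ, ℝ) (g i) y := fun i hi ↦
    hg i ((ρ.mem_fintsupport_iff y i).1 hi)
  have hprod : differential (n := n) (fun z ↦ ∑ᶠ i, ρ i z • g i z) y =
      ∑ i ∈ ρ.fintsupport y, (ρ i y • differential (g i) y + g i y • differential (ρ i) y) := by
    rw [differential_congr (finsum_smul_eventuallyEq_sum_fintsupport ρ g y), differential_sum
      fun i hi ↦ ((hρ i).hasMFDerivAt.mul (hgy i hi).hasMFDerivAt).mdifferentiableAt]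
    exact Finset.sum_congr rfl fun i hi ↦ differential_mul (hρ i) (hgy i hi)
  rw [hprod, ← sub_zero (∑ i ∈ _, _), ← smul_zero c, ← sum_fintsupport_differential_eq_zero ρ y,
    Finset.smul_sum, ← Finset.sum_sub_distrib]
  refine Finset.sum_congr rfl fun i _ ↦ ContinuousLinearMap.ext fun w ↦ ?_
  simp only [add_apply, sub_apply, smul_apply, smul_eq_mul]
  ring

variable [Bundle.RiemannianBundle (fun x : M ↦ TangentSpace (𝓡 n) x)]

theorem covectorNorm_differential_finsum_smul_le {g : ι → M → ℝ} {c C : ℝ} {ε : ι → ℝ}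
    (hg : ∀ i, y ∈ tsupport (ρ i) → MDifferentiableAt (𝓡 n) 𝓘(ℝ, ℝ) (g i) y)
    (hdg : ∀ i, y ∈ tsupport (ρ i) → covectorNorm (differential (n := n) (g i) y) ≤ C)
    (hε : ∀ i, y ∈ tsupport (ρ i) →
      |g i y - c| * covectorNorm (differential (n := n) (ρ i) y) ≤ ε i) :
    covectorNorm (differential (n := n) (fun z ↦ ∑ᶠ i, ρ i z • g i z) y) ≤
      C + ∑ i ∈ ρ.fintsupport y, ε i := by
  have hsum : ∑ i ∈ ρ.fintsupport y, ρ i y = 1 :=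
    ρ.sum_finsupport' y (mem_univ y) (ρ.finsupport_subset_fintsupport y)
  rw [differential_finsum_smul ρ hg c]
  calc covectorNorm (∑ i ∈ ρ.fintsupport y,
        (ρ i y • differential (n := n) (g i) y + (g i y - c) • differential (ρ i) y))
      ≤ ∑ i ∈ ρ.fintsupport y, (ρ i y * C + ε i) := by
        refine (covectorNorm_sum_le _ _).trans (Finset.sum_le_sum fun i hi ↦ ?_)
        rw [ρ.mem_fintsupport_iff] at hi
        refine (covectorNorm_add_le _ _).trans (add_le_add ?_ ?_)
        · refine (covectorNorm_smul_le _ _).trans ?_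
          rw [abs_of_nonneg (ρ.nonneg i y)]
          exact mul_le_mul_of_nonneg_left (hdg i hi) (ρ.nonneg i y)
        · exact (covectorNorm_smul_le _ _).trans (hε i hi)
    _ = C + ∑ i ∈ ρ.fintsupport y, ε i := by
        rw [Finset.sum_add_distrib, ← Finset.sum_mul, hsum, one_mul]

end Gluing

section GlobalApproximation

variable {n : ℕ} {M : Type*} [MetricSpace M] [ChartedSpace (EuclideanSpace ℝ (Fin n)) M]
  [IsManifold (𝓡 n) ∞ M]

theorem exists_smoothPartitionOfUnity_isSubordinate_hasCompactSupport [SigmaCompactSpace M]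
    {U : M → Set M} (hU : ∀ x, IsOpen (U x)) (hxU : ∀ x, x ∈ U x) :
    ∃ s : Set M, Countable s ∧ ∃ ρ : SmoothPartitionOfUnity s (𝓡 n) M univ,
      ρ.IsSubordinate (fun x ↦ U x) ∧ ∀ i, HasCompactSupport (ρ i) := by
  have : LocallyCompactSpace M := ChartedSpace.locallyCompactSpace (EuclideanSpace ℝ (Fin n)) M
  choose K hK hxK using exists_compact_mem_nhds (X := M)
  let V : M → Set M := fun x ↦ U x ∩ interior (K x)
  obtain ⟨s, hs, hsV⟩ := countable_cover_nhds_of_sigmaCompact fun x ↦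
    inter_mem ((hU x).mem_nhds (hxU x)) (interior_mem_nhds.2 (hxK x))
  obtain ⟨ρ, hρ⟩ := SmoothPartitionOfUnity.exists_isSubordinate (𝓡 n) isClosed_univ
    (fun x : s ↦ V x) (fun x ↦ (hU x).inter isOpen_interior) (by
      rw [iUnion_subtype, hsV])
  refine ⟨s, hs.to_subtype, ρ, fun i ↦ (hρ i).trans inter_subset_left, fun i ↦ ?_⟩
  exact (hK i).of_isClosed_subset (isClosed_tsupport _)
    ((hρ i).trans (inter_subset_right.trans interior_subset))

variable [Bundle.RiemannianBundle (fun x : M ↦ TangentSpace (𝓡 n) x)]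
  [IsContinuousRiemannianBundle (EuclideanSpace ℝ (Fin n)) (fun x : M ↦ TangentSpace (𝓡 n) x)]
  [IsRiemannianManifold (𝓡 n) M]

theorem exists_contMDiff_approx [SigmaCompactSpace M] {f : M → ℝ} {C C' : ℝ≥0}
    (hf : LipschitzWith C f) (hC : C < C') {ε : ℝ} (hε : 0 < ε) :
    ∃ h : M → ℝ, ContMDiff (𝓡 n) 𝓘(ℝ, ℝ) ∞ h ∧ (∀ y, |h y - f y| ≤ ε) ∧
      ∀ y, covectorNorm (differential (n := n) h y) ≤ C' := by
  obtain ⟨C'', hC'', hC'⟩ := exists_between hC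
  choose U hUo hxU hU using exists_nhds_contMDiffOn_approx (n := n) hf hC''
  obtain ⟨s, hs, ρ, hρ, hρc⟩ :=
    exists_smoothPartitionOfUnity_isSubordinate_hasCompactSupport (n := n) hUo hxU
  choose B hB using fun i ↦
    exists_covectorNorm_differential_le ((ρ i).contMDiff.of_le (by simp)) (hρc i)
  have hB0 : ∀ i, 0 ≤ B i := fun i ↦ (covectorNorm_nonneg _).trans (hB i i)
  obtain ⟨η, hη, hηsum⟩ :=
    (countable_univ (α := s)).exists_pos_forall_sum_le (sub_pos.2 (NNReal.coe_lt_coe.2 hC'))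
  let δ : s → ℝ := fun i ↦ min ε (η i / (1 + B i))
  have hδ : ∀ i, 0 < δ i := fun i ↦
    lt_min hε (div_pos (hη i) (add_pos_of_pos_of_nonneg one_pos (hB0 i)))
  choose g hg hgf hdg using fun i : s ↦ hU i (δ i) (hδ i)
  refine ⟨fun z ↦ ∑ᶠ i, ρ i z • g i z, hρ.contMDiff_finsum_smul (fun i ↦ hUo i) hg,
    fun y ↦ ?_, fun y ↦ ?_⟩
  · refine ρ.finsum_smul_mem_convex (t := closedBall (f y) ε) (mem_univ y) (fun i hi ↦ ?_)
      (convex_closedBall _ _)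
    exact (hgf i y (hρ i (subset_tsupport _ hi))).trans (min_le_left _ _)
  · refine (covectorNorm_differential_finsum_smul_le ρ (c := f y) (C := C'') (ε := η)
      (fun i hi ↦ ((hg i).contMDiffAt ((hUo i).mem_nhds (hρ i hi))).mdifferentiableAt (by simp))
      (fun i hi ↦ hdg i y (hρ i hi)) fun i hi ↦ ?_).trans ?_
    · calc |g i y - f y| * covectorNorm (differential (n := n) (ρ i) y)
          ≤ δ i * (1 + B i) := by
            gcongr
            exacts [covectorNorm_nonneg _, (hδ i).le, hgf i y (hρ i hi), (hB i y).trans (by simp)]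
        _ ≤ η i := (le_div_iff₀ (by linarith [hB0 i])).1 (min_le_right _ _)
    · linarith [hηsum (ρ.fintsupport y) (subset_univ _)]

theorem exists_contMDiff_exhaustion [ProperSpace M] :
    ∃ h : M → ℝ, ContMDiff (𝓡 n) 𝓘(ℝ, ℝ) ∞ h ∧ (∀ R, IsCompact (h ⁻¹' closedBall 0 R)) ∧
      ∀ y, covectorNorm (differential (n := n) h y) ≤ 2 := by
  rcases isEmpty_or_nonempty M with _ | ⟨⟨x₀⟩⟩
  · exact ⟨0, contMDiff_const, fun R ↦ (Set.toFinite _).isCompact, isEmptyElim⟩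
  obtain ⟨h, hh, hdist, hdh⟩ :=
    exists_contMDiff_approx (n := n) (LipschitzWith.dist_left x₀) one_lt_two one_pos
  refine ⟨h, hh, fun R ↦ ?_, hdh⟩
  refine (isCompact_closedBall x₀ (R + 1)).of_isClosed_subset
    (isClosed_closedBall.preimage hh.continuous) fun y hy ↦ ?_
  have hhR : |h y| ≤ R := by simpa using hy
  rw [mem_closedBall]
  linarith [(abs_le.1 (hdist y)).1, (abs_le.1 hhR).2]

theorem exists_cutoff [ProperSpace M] :
    ∃ (χ : ℕ → M → ℝ) (D : ℝ), (∀ k, ContMDiff (𝓡 n) 𝓘(ℝ, ℝ) ∞ (χ k)) ∧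
      (∀ k, HasCompactSupport (χ k)) ∧ (∀ k y, |χ k y| ≤ 1) ∧ (∀ y, ∀ᶠ k in atTop, χ k y = 1) ∧
      ∀ k y, covectorNorm (differential (n := n) (χ k) y) ≤ D / (k + 1) := by
  obtain ⟨h, hh, hcpt, hdh⟩ := exists_contMDiff_exhaustion (n := n) (M := M)
  let b : ContDiffBump (0 : ℝ) := ⟨1, 2, one_pos, one_lt_two⟩
  obtain ⟨D, hD⟩ := (b.contDiff.continuous_deriv (n := 1) le_rfl).bounded_above_of_compact_support
    b.hasCompactSupport.deriv
  have hD0 : 0 ≤ D := (norm_nonneg _).trans (hD 0)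
  let c : ℕ → ℝ := fun k ↦ ((k : ℝ) + 1)⁻¹
  have hc : ∀ k, 0 < c k := fun k ↦ by positivity
  have hb : ∀ k, ContDiff ℝ ∞ fun s ↦ b (c k * s) := fun k ↦ b.contDiff.comp (by fun_prop)
  refine ⟨fun k ↦ (fun s ↦ b (c k * s)) ∘ h, D * 2, fun k ↦ (hb k).contMDiff.comp hh, fun k ↦ ?_,
    fun k y ↦ ?_, fun y ↦ ?_, fun k y ↦ ?_⟩
  · refine .intro (hcpt (2 / c k)) fun y hy ↦ b.zero_of_le_dist ?_
    rw [mem_preimage, mem_closedBall_zero_iff, not_le, div_lt_iff₀' (hc k)] at hy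
    simpa [abs_of_pos (hc k)] using hy.le
  · exact abs_le.2 ⟨neg_one_lt_zero.le.trans b.nonneg, b.le_one⟩
  · have hlim : Tendsto (fun k ↦ c k * h y) atTop (𝓝 0) := by
      simpa [c, one_div] using (tendsto_one_div_add_atTop_nhds_zero_nat (𝕜 := ℝ)).mul_const (h y)
    filter_upwards [hlim.eventually (closedBall_mem_nhds 0 one_pos)] with k hk
    exact b.one_of_mem_closedBall hk
  · rw [differential_comp ((hb k).differentiable (by simp) _) (hh.mdifferentiableAt (by simp)),
      deriv_comp_mul_left]
    refine (covectorNorm_smul_le _ _).trans ?_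
    calc |c k • deriv b (c k * h y)| * covectorNorm (differential (n := n) h y)
        ≤ (c k * D) * 2 := by
          rw [smul_eq_mul, abs_mul, abs_of_pos (hc k)]
          exact mul_le_mul (mul_le_mul_of_nonneg_left (hD _) (hc k).le) (hdh y)
            (covectorNorm_nonneg _) (mul_nonneg (hc k).le hD0)
      _ = D * 2 / (k + 1) := by simp only [c]; ring

end GlobalApproximation

section SoftThreshold

/-- A smooth version of the soft thresholding `s ↦ sign s * (|s| - r)₊`: the slope vanishes where
the bump function `b` is `1` and is `1` where `b` vanishes. -/
def softThreshold (b : ContDiffBump (0 : ℝ)) (s : ℝ) : ℝ :=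
  ∫ x in (0 : ℝ)..s, (1 - b x)

variable (b : ContDiffBump (0 : ℝ))

theorem hasDerivAt_softThreshold (s : ℝ) : HasDerivAt (softThreshold b) (1 - b s) s :=
  (continuous_const.sub b.continuous).integral_hasStrictDerivAt 0 s |>.hasDerivAt

theorem contDiff_softThreshold : ContDiff ℝ ∞ (softThreshold b) := by
  refine contDiff_infty_iff_deriv.2
    ⟨fun s ↦ (hasDerivAt_softThreshold b s).differentiableAt, ?_⟩
  rw [funext fun s ↦ (hasDerivAt_softThreshold b s).deriv]
  exact contDiff_const.sub b.contDiff

theorem softThreshold_eq_zero {s : ℝ} (hs : |s| ≤ b.rIn) : softThreshold b s = 0 := by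
  refine intervalIntegral.integral_zero_ae (.of_forall fun x hx ↦ sub_eq_zero.2 ?_)
  have hxs : |x - 0| ≤ |s - 0| := abs_sub_left_of_mem_uIcc (uIoc_subset_uIcc hx)
  refine (b.one_of_mem_closedBall ?_).symm
  rw [mem_closedBall, Real.dist_eq]
  exact hxs.trans (by rwa [sub_zero])

theorem abs_softThreshold_le (s : ℝ) : |softThreshold b s| ≤ |s| := by
  have h : ‖softThreshold b s‖ ≤ 1 * |s - 0| :=
    intervalIntegral.norm_integral_le_of_norm_le_const fun x _ ↦
      abs_le.2 ⟨by linarith [b.le_one (x := x)], by linarith [b.nonneg (x := x)]⟩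
  simpa using h

theorem self_sub_softThreshold (s : ℝ) : s - softThreshold b s = ∫ x in (0 : ℝ)..s, b x := by
  rw [softThreshold, intervalIntegral.integral_sub intervalIntegrable_const
    (b.continuous.intervalIntegrable 0 s)]
  simp

theorem abs_self_sub_softThreshold_le (s : ℝ) : |s - softThreshold b s| ≤ |s| := by
  have h : ‖∫ x in (0 : ℝ)..s, b x‖ ≤ 1 * |s - 0| :=
    intervalIntegral.norm_integral_le_of_norm_le_const fun x _ ↦ by
      rw [Real.norm_of_nonneg b.nonneg]
      exact b.le_one
  rw [self_sub_softThreshold]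
  simpa using h

theorem abs_self_sub_softThreshold_le_rOut (s : ℝ) : |s - softThreshold b s| ≤ 2 * b.rOut :=
  calc |s - softThreshold b s|
      = ‖∫ x in (0 : ℝ)..s, b x‖ := by rw [self_sub_softThreshold, Real.norm_eq_abs]
    _ ≤ ∫ x in uIoc 0 s, ‖b x‖ := intervalIntegral.norm_integral_le_integral_norm_uIoc
    _ = ∫ x in uIoc 0 s, b x := by simp only [Real.norm_of_nonneg b.nonneg]
    _ ≤ ∫ x, b x := setIntegral_le_integral b.integrable (.of_forall fun _ ↦ b.nonneg)
    _ ≤ volume.real (closedBall (0 : ℝ) b.rOut) := b.integral_le_measure_closedBall volume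
    _ = 2 * b.rOut := by rw [Real.volume_real_closedBall b.rOut_pos.le]

end SoftThreshold

section LpNorm

variable {S E : Type*} [MeasurableSpace S] {μ : Measure S} [NormedAddCommGroup E] {f : S → E}

theorem eLpNorm_le_rpow_mul_rpow_of_enorm_le {p q : ℝ} (hp : 0 < p) (hpq : p ≤ q) {C : ℝ≥0∞}
    (hC : C ≠ ⊤) (hf : ∀ x, ‖f x‖ₑ ≤ C) :
    eLpNorm f (ENNReal.ofReal q) μ ≤
      C ^ ((q - p) / q) * eLpNorm f (ENNReal.ofReal p) μ ^ (p / q) := by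
  have hq : 0 < q := hp.trans_le hpq
  have hqp : 0 ≤ q - p := sub_nonneg.2 hpq
  have hint : ∫⁻ x, ‖f x‖ₑ ^ q ∂μ ≤ C ^ (q - p) * ∫⁻ x, ‖f x‖ₑ ^ p ∂μ := by
    rw [← lintegral_const_mul' _ _ (ENNReal.rpow_ne_top_of_nonneg hqp hC)]
    refine lintegral_mono fun x ↦ ?_
    calc ‖f x‖ₑ ^ q = ‖f x‖ₑ ^ (q - p) * ‖f x‖ₑ ^ p := by
          rw [← ENNReal.rpow_add_of_nonneg _ _ hqp hp.le, sub_add_cancel]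
      _ ≤ C ^ (q - p) * ‖f x‖ₑ ^ p := by gcongr; exact hf x
  simp only [eLpNorm_eq_lintegral_rpow_enorm_toReal (ENNReal.ofReal_pos.2 hp).ne'
    ENNReal.ofReal_ne_top, eLpNorm_eq_lintegral_rpow_enorm_toReal (ENNReal.ofReal_pos.2 hq).ne'
    ENNReal.ofReal_ne_top, ENNReal.toReal_ofReal hp.le, ENNReal.toReal_ofReal hq.le]
  calc (∫⁻ x, ‖f x‖ₑ ^ q ∂μ) ^ (1 / q)
      ≤ (C ^ (q - p) * ∫⁻ x, ‖f x‖ₑ ^ p ∂μ) ^ (1 / q) := by gcongr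
    _ = C ^ ((q - p) / q) * ((∫⁻ x, ‖f x‖ₑ ^ p ∂μ) ^ (1 / p)) ^ (p / q) := by
        rw [ENNReal.mul_rpow_of_nonneg _ _ (by positivity), ← ENNReal.rpow_mul, ← ENNReal.rpow_mul,
          mul_one_div, div_mul_div_cancel₀ hp.ne']

theorem eLpNorm_le_rpow_mul_eLpNorm {F : Type*} [NormedAddCommGroup F] {g : S → F} {p q : ℝ}
    (hp : 0 < p) (hpq : p ≤ q) {D : ℝ≥0∞} (hD : D * eLpNorm g (ENNReal.ofReal p) μ ≠ ⊤)
    (hfg : ∀ x, ‖f x‖ ≤ ‖g x‖) (hf : ∀ x, ‖f x‖ₑ ≤ D * eLpNorm g (ENNReal.ofReal p) μ) :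
    eLpNorm f (ENNReal.ofReal q) μ ≤ D ^ ((q - p) / q) * eLpNorm g (ENNReal.ofReal p) μ := by
  have hq : 0 < q := hp.trans_le hpq
  have hqp : 0 ≤ (q - p) / q := div_nonneg (sub_nonneg.2 hpq) hq.le
  set N := eLpNorm g (ENNReal.ofReal p) μ
  calc eLpNorm f (ENNReal.ofReal q) μ
      ≤ (D * N) ^ ((q - p) / q) * eLpNorm f (ENNReal.ofReal p) μ ^ (p / q) :=
        eLpNorm_le_rpow_mul_rpow_of_enorm_le hp hpq hD hf
    _ ≤ (D * N) ^ ((q - p) / q) * N ^ (p / q) := by gcongr; exact eLpNorm_mono hfg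
    _ = D ^ ((q - p) / q) * N := by
        rw [ENNReal.mul_rpow_of_nonneg _ _ hqp, mul_assoc,
          ← ENNReal.rpow_add_of_nonneg _ _ hqp (by positivity), ← add_div, sub_add_cancel,
          div_self hq.ne', ENNReal.rpow_one]

theorem measure_rpow_mul_eLpNorm_le_enorm_le (hf : AEStronglyMeasurable f μ) {p : ℝ} (hp : 0 < p)
    {τ : ℝ≥0∞} (hτ : τ ≠ 0) (hτ' : τ ≠ ⊤) (h0 : eLpNorm f (ENNReal.ofReal p) μ ≠ 0)
    (h1 : eLpNorm f (ENNReal.ofReal p) μ ≠ ⊤) :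
    μ {x | τ ^ (-(1 / p)) * eLpNorm f (ENNReal.ofReal p) μ ≤ ‖f x‖ₑ} ≤ τ := by
  have hMarkov := mul_meas_ge_le_pow_eLpNorm' μ (ENNReal.ofReal_pos.2 hp).ne' ENNReal.ofReal_ne_top
    hf (τ ^ (-(1 / p)) * eLpNorm f (ENNReal.ofReal p) μ)
  rw [ENNReal.toReal_ofReal hp.le, ENNReal.mul_rpow_of_nonneg _ _ hp.le, ← ENNReal.rpow_mul,
    neg_mul, one_div_mul_cancel hp.ne', ENNReal.rpow_neg_one, mul_right_comm] at hMarkov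
  have hNp0 : eLpNorm f (ENNReal.ofReal p) μ ^ p ≠ 0 := by simp [h0, h1]
  have hNp1 : eLpNorm f (ENNReal.ofReal p) μ ^ p ≠ ⊤ := ENNReal.rpow_ne_top_of_nonneg hp.le h1
  have hcancel := (ENNReal.mul_le_mul_iff_left hNp0 hNp1).1 (hMarkov.trans_eq (one_mul _).symm)
  rwa [mul_comm, ← div_eq_mul_inv, ENNReal.div_le_iff hτ hτ', one_mul] at hcancel

theorem eLpNorm_le_of_tendsto_ae {f : ℕ → S → E} {g : S → E} {q : ℝ≥0∞} {c : ℕ → ℝ≥0∞}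
    {c' : ℝ≥0∞} (hf : ∀ k, AEStronglyMeasurable (f k) μ)
    (hfg : ∀ᵐ x ∂μ, Tendsto (fun k ↦ f k x) atTop (𝓝 (g x)))
    (hle : ∀ k, eLpNorm (f k) q μ ≤ c k) (hc : Tendsto c atTop (𝓝 c')) :
    eLpNorm g q μ ≤ c' :=
  calc eLpNorm g q μ ≤ liminf (fun k ↦ eLpNorm (f k) q μ) atTop :=
        Lp.eLpNorm_lim_le_liminf_eLpNorm hf g hfg
    _ ≤ liminf c atTop := liminf_le_liminf (.of_forall hle)
    _ = c' := hc.liminf_eq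

end LpNorm

section Sobolev

variable {n : ℕ} {M : Type*} [MetricSpace M] [ChartedSpace (EuclideanSpace ℝ (Fin n)) M]
  [Bundle.RiemannianBundle (fun x : M ↦ TangentSpace (𝓡 n) x)]

theorem exists_contMDiff_truncation {φ : M → ℝ} (hφ : ContMDiff (𝓡 n) 𝓘(ℝ, ℝ) ∞ φ)
    (hc : HasCompactSupport φ) {t : ℝ} (ht : 0 < t) :
    ∃ v : M → ℝ, ContMDiff (𝓡 n) 𝓘(ℝ, ℝ) ∞ v ∧ HasCompactSupport v ∧
      tsupport v ⊆ {x | t < |φ x|} ∧ (∀ x, |v x| ≤ |φ x|) ∧ (∀ x, |φ x - v x| ≤ |φ x|) ∧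
      (∀ x, |φ x - v x| ≤ 6 * t) ∧
      ∀ x, covectorNorm (differential (n := n) v x) ≤ covectorNorm (differential (n := n) φ x) := by
  let b : ContDiffBump (0 : ℝ) := ⟨2 * t, 3 * t, by positivity, by linarith⟩
  refine ⟨softThreshold b ∘ φ, (contDiff_softThreshold b).contMDiff.comp hφ,
    hc.comp_left (softThreshold_eq_zero b (by rw [abs_zero]; exact b.rIn_pos.le)), fun x hx ↦ ?_,
    fun x ↦ abs_softThreshold_le b _, fun x ↦ abs_self_sub_softThreshold_le b _,
    fun x ↦ (abs_self_sub_softThreshold_le_rOut b _).trans_eq (by simp only [b]; ring),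
    fun x ↦ ?_⟩
  · have hsupp : tsupport (softThreshold b ∘ φ) ⊆ {x | b.rIn ≤ |φ x|} :=
      closure_minimal (fun y hy ↦ le_of_not_ge fun hle ↦ hy (softThreshold_eq_zero b hle))
        (isClosed_le continuous_const hφ.continuous.abs)
    have hx' : 2 * t ≤ |φ x| := hsupp hx
    exact lt_of_lt_of_le (by linarith) hx'
  · have hderiv := hasDerivAt_softThreshold b (φ x)
    rw [differential_comp hderiv.differentiableAt (hφ.mdifferentiableAt (by simp)), hderiv.deriv]
    refine (covectorNorm_smul_le _ _).trans
      (mul_le_of_le_one_left (covectorNorm_nonneg _) (abs_le.2 ⟨?_, ?_⟩))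
    · linarith [b.le_one (x := φ x)]
    · linarith [b.nonneg (x := φ x)]

variable [MeasurableSpace M]

theorem memW₀_of_contMDiff {Ω : Set M} {p : ℝ} {φ : M → ℝ}
    (hm : AEStronglyMeasurable φ (riemannianVolume n M))
    (hφ : ContMDiff (𝓡 n) 𝓘(ℝ, ℝ) ∞ φ) (hc : HasCompactSupport φ) (hΩ : tsupport φ ⊆ Ω) :
    MemW₀ Ω p φ (differential (n := n) φ) := by
  refine ⟨hm, fun _ ↦ φ, fun _ ↦ ⟨hc, hΩ⟩, fun _ ↦ hφ, fun _ ↦ ?_, ?_, ?_⟩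
  · simp only [sub_self, covectorNorm_zero]
    exact aestronglyMeasurable_const
  · simp only [sub_self, eLpNorm_zero', tendsto_const_nhds_iff]
  · simp only [sub_self, covectorNorm_zero, eLpNorm_zero', tendsto_const_nhds_iff]

variable {p q α A B : ℝ} {u v : M → ℝ} {X Y : (x : M) → TangentSpace (𝓡 n) x →L[ℝ] ℝ}

theorem SobolevInequality.of_eLpNorm_sub_le (hq : 1 ≤ q) (hα : 0 < α) (hα1 : α ≤ 1) (hB : 0 ≤ B)
    {K : ℝ} (hK : 0 ≤ K) (hu : AEStronglyMeasurable u (riemannianVolume n M))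
    (hv : AEStronglyMeasurable v (riemannianVolume n M)) (h : SobolevInequality p q α A B v Y)
    (hXY : ∀ x, covectorNorm (Y x) ≤ covectorNorm (X x)) (huv : ∀ x, |v x| ≤ |u x|)
    (hsub : eLpNorm (u - v) (ENNReal.ofReal q) (riemannianVolume n M) ≤
      ENNReal.ofReal K * eLpNorm u (ENNReal.ofReal p) (riemannianVolume n M)) :
    SobolevInequality p q α A (B + K ^ α) u X := by
  unfold SobolevInequality at h ⊢
  set μ := riemannianVolume n M
  have hgrad : eLpNorm (fun x ↦ covectorNorm (Y x)) (ENNReal.ofReal p) μ ≤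
      eLpNorm (fun x ↦ covectorNorm (X x)) (ENNReal.ofReal p) μ :=
    eLpNorm_mono_real fun x ↦ (Real.norm_of_nonneg (covectorNorm_nonneg _)).trans_le (hXY x)
  have hvu : eLpNorm v (ENNReal.ofReal p) μ ≤ eLpNorm u (ENNReal.ofReal p) μ := eLpNorm_mono huv
  have htri : eLpNorm u (ENNReal.ofReal q) μ ≤
      eLpNorm v (ENNReal.ofReal q) μ + eLpNorm (u - v) (ENNReal.ofReal q) μ := by
    simpa only [add_sub_cancel] using eLpNorm_add_le hv (hu.sub hv) (ENNReal.one_le_ofReal.2 hq)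
  calc eLpNorm u (ENNReal.ofReal q) μ ^ α
      ≤ (eLpNorm v (ENNReal.ofReal q) μ + eLpNorm (u - v) (ENNReal.ofReal q) μ) ^ α := by gcongr
    _ ≤ eLpNorm v (ENNReal.ofReal q) μ ^ α + eLpNorm (u - v) (ENNReal.ofReal q) μ ^ α :=
        ENNReal.rpow_add_le_add_rpow _ _ hα.le hα1
    _ ≤ (ENNReal.ofReal A * eLpNorm (fun x ↦ covectorNorm (X x)) (ENNReal.ofReal p) μ ^ α +
          ENNReal.ofReal B * eLpNorm u (ENNReal.ofReal p) μ ^ α) +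
          (ENNReal.ofReal K * eLpNorm u (ENNReal.ofReal p) μ) ^ α := by
        refine add_le_add (h.trans ?_) (by gcongr)
        gcongr
    _ = _ := by
        rw [ENNReal.ofReal_add hB (by positivity), ENNReal.mul_rpow_of_nonneg _ _ hα.le,
          ENNReal.ofReal_rpow_of_nonneg hK hα.le, add_mul, add_assoc]

theorem SobolevInequality.of_tendsto (hα : 0 < α) {f : ℕ → M → ℝ}
    {Y : ℕ → (x : M) → TangentSpace (𝓡 n) x →L[ℝ] ℝ} {a b : ℕ → ℝ≥0∞}
    (h : ∀ k, SobolevInequality p q α A B (f k) (Y k))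
    (hf : ∀ k, AEStronglyMeasurable (f k) (riemannianVolume n M))
    (hfu : ∀ᵐ x ∂riemannianVolume n M, Tendsto (fun k ↦ f k x) atTop (𝓝 (u x)))
    (hfa : ∀ k, eLpNorm (f k) (ENNReal.ofReal p) (riemannianVolume n M) ≤
      eLpNorm u (ENNReal.ofReal p) (riemannianVolume n M) + a k)
    (ha : Tendsto a atTop (𝓝 0))
    (hYb : ∀ k, eLpNorm (fun x ↦ covectorNorm (Y k x)) (ENNReal.ofReal p) (riemannianVolume n M) ≤
      eLpNorm (fun x ↦ covectorNorm (X x)) (ENNReal.ofReal p) (riemannianVolume n M) + b k)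
    (hb : Tendsto b atTop (𝓝 0)) : SobolevInequality p q α A B u X := by
  have hlim (A N : ℝ≥0∞) {c : ℕ → ℝ≥0∞} (hA : A ≠ ⊤) (hc : Tendsto c atTop (𝓝 0)) :
      Tendsto (fun k ↦ A * (N + c k) ^ α) atTop (𝓝 (A * N ^ α)) := by
    have hN : Tendsto (fun k ↦ N + c k) atTop (𝓝 N) := by
      simpa only [add_zero] using tendsto_const_nhds.add hc
    exact ENNReal.Tendsto.const_mul ((ENNReal.continuous_rpow_const.tendsto N).comp hN) (.inr hA)
  refine (ENNReal.le_rpow_inv_iff hα).1 (eLpNorm_le_of_tendsto_ae hf hfu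
    (fun k ↦ (ENNReal.le_rpow_inv_iff hα).2 ((h k).trans ?_))
    ((ENNReal.continuous_rpow_const.tendsto _).comp ((hlim _ _ ENNReal.ofReal_ne_top hb).add
      (hlim _ _ ENNReal.ofReal_ne_top ha))))
  gcongr
  exacts [hYb k, hfa k]

theorem exists_truncation_eLpNorm_sub_le [BorelSpace M] {τ : ℝ} (hp : 0 < p) (hpq : p ≤ q)
    (hτ : 0 < τ) {φ : M → ℝ} (hφ : ContMDiff (𝓡 n) 𝓘(ℝ, ℝ) ∞ φ) (hc : HasCompactSupport φ)
    (hφ0 : eLpNorm φ (ENNReal.ofReal p) (riemannianVolume n M) ≠ 0)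
    (hφ1 : eLpNorm φ (ENNReal.ofReal p) (riemannianVolume n M) ≠ ⊤) :
    ∃ (v : M → ℝ) (Ω : Set M), IsOpen Ω ∧ riemannianVolume n M Ω ≤ ENNReal.ofReal τ ∧
      ContMDiff (𝓡 n) 𝓘(ℝ, ℝ) ∞ v ∧ HasCompactSupport v ∧ tsupport v ⊆ Ω ∧
      (∀ x, |v x| ≤ |φ x|) ∧
      (∀ x, covectorNorm (differential (n := n) v x) ≤ covectorNorm (differential (n := n) φ x)) ∧
      eLpNorm (φ - v) (ENNReal.ofReal q) (riemannianVolume n M) ≤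
        ENNReal.ofReal ((6 * τ ^ (-(1 / p))) ^ ((q - p) / q)) *
          eLpNorm φ (ENNReal.ofReal p) (riemannianVolume n M) := by
  set N := eLpNorm φ (ENNReal.ofReal p) (riemannianVolume n M)
  set t : ℝ := τ ^ (-(1 / p)) * N.toReal with ht
  have ht0 : 0 < t := mul_pos (by positivity) (ENNReal.toReal_pos hφ0 hφ1)
  have htN : ENNReal.ofReal t = ENNReal.ofReal τ ^ (-(1 / p)) * N := by
    rw [ENNReal.ofReal_mul (by positivity), ENNReal.ofReal_toReal hφ1,
      ENNReal.ofReal_rpow_of_pos hτ]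
  have h6t : ENNReal.ofReal (6 * t) = ENNReal.ofReal (6 * τ ^ (-(1 / p))) * N := by
    rw [ht, ← mul_assoc, ENNReal.ofReal_mul (by positivity), ENNReal.ofReal_toReal hφ1]
  obtain ⟨v, hv, hvc, hvsupp, hvφ, hsub, hsubt, hdv⟩ := exists_contMDiff_truncation hφ hc ht0
  refine ⟨v, {x | t < |φ x|}, isOpen_lt continuous_const hφ.continuous.abs, ?_, hv, hvc, hvsupp,
    hvφ, hdv, ?_⟩
  · refine (measure_mono fun x (hx : t < |φ x|) ↦ ?_).trans (measure_rpow_mul_eLpNorm_le_enorm_le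
      hφ.continuous.aestronglyMeasurable hp (ENNReal.ofReal_pos.2 hτ).ne' ENNReal.ofReal_ne_top
      hφ0 hφ1)
    rw [mem_ofPred_eq, ← htN, ← ofReal_norm]
    exact ENNReal.ofReal_le_ofReal hx.le
  · rw [← ENNReal.ofReal_rpow_of_pos (by positivity)]
    refine eLpNorm_le_rpow_mul_eLpNorm hp hpq (h6t ▸ ENNReal.ofReal_ne_top) hsub fun x ↦ ?_
    rw [← h6t, ← ofReal_norm]
    exact ENNReal.ofReal_le_ofReal (hsubt x)

theorem sobolevInequality_of_hasCompactSupport [BorelSpace M] {τ : ℝ} (hp : 1 ≤ p) (hpq : p ≤ q)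
    (hα : 0 < α) (hα1 : α ≤ 1) (hτ : 0 < τ) (hB : 0 ≤ B)
    (h : ∀ Ω : Set M, IsOpen Ω → riemannianVolume n M Ω ≤ ENNReal.ofReal τ →
      ∀ (u : M → ℝ) (X : (x : M) → TangentSpace (𝓡 n) x →L[ℝ] ℝ),
        MemW₀ Ω p u X → SobolevInequality p q α A B u X)
    {φ : M → ℝ} (hφ : ContMDiff (𝓡 n) 𝓘(ℝ, ℝ) ∞ φ) (hc : HasCompactSupport φ) :
    SobolevInequality p q α A (B + ((6 * τ ^ (-(1 / p))) ^ ((q - p) / q)) ^ α) φ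
      (differential (n := n) φ) := by
  have hp0 : 0 < p := one_pos.trans_le hp
  have hφm : AEStronglyMeasurable φ (riemannianVolume n M) := hφ.continuous.aestronglyMeasurable
  by_cases hφ1 : eLpNorm φ (ENNReal.ofReal p) (riemannianVolume n M) = ⊤
  · have hB' : 0 < B + ((6 * τ ^ (-(1 / p))) ^ ((q - p) / q)) ^ α := by positivity
    rw [SobolevInequality, hφ1, ENNReal.top_rpow_of_pos hα,
      ENNReal.mul_top (ENNReal.ofReal_pos.2 hB').ne', add_top]
    exact le_top
  by_cases hφ0 : eLpNorm φ (ENNReal.ofReal p) (riemannianVolume n M) = 0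
  · have hφae : φ =ᵐ[riemannianVolume n M] 0 :=
      (eLpNorm_eq_zero_iff hφm (ENNReal.ofReal_pos.2 hp0).ne').1 hφ0
    rw [SobolevInequality, eLpNorm_congr_ae hφae, eLpNorm_zero, ENNReal.zero_rpow_of_pos hα]
    exact bot_le
  obtain ⟨v, Ω, hΩ, hvol, hv, hvc, hvΩ, hvφ, hdv, hsub⟩ :=
    exists_truncation_eLpNorm_sub_le hp0 hpq hτ hφ hc hφ0 hφ1
  have hvm : AEStronglyMeasurable v (riemannianVolume n M) := hv.continuous.aestronglyMeasurable
  exact (h Ω hΩ hvol v _ (memW₀_of_contMDiff hvm hv hvc hvΩ)).of_eLpNorm_sub_le (hp.trans hpq)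
    hα hα1 hB (by positivity) hφm hvm hdv hvφ hsub

theorem eLpNorm_covectorNorm_differential_mul_le {χ φ : M → ℝ} {c : ℝ} (hp : 1 ≤ p) (hc : 0 ≤ c)
    (hχ : MDifferentiable (𝓡 n) 𝓘(ℝ, ℝ) χ) (hφ : MDifferentiable (𝓡 n) 𝓘(ℝ, ℝ) φ)
    (hχ1 : ∀ x, |χ x| ≤ 1) (hdχ : ∀ x, covectorNorm (differential (n := n) χ x) ≤ c)
    (hφm : AEStronglyMeasurable φ (riemannianVolume n M))
    (hdφm : AEStronglyMeasurable (fun x ↦ covectorNorm (differential (n := n) φ x))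
      (riemannianVolume n M)) :
    eLpNorm (fun x ↦ covectorNorm (differential (n := n) (χ * φ) x)) (ENNReal.ofReal p)
        (riemannianVolume n M) ≤
      eLpNorm (fun x ↦ covectorNorm (differential (n := n) φ x)) (ENNReal.ofReal p)
          (riemannianVolume n M) +
        ENNReal.ofReal c * eLpNorm φ (ENNReal.ofReal p) (riemannianVolume n M) := by
  have hpoint (x : M) : covectorNorm (differential (n := n) (χ * φ) x) ≤
      covectorNorm (differential (n := n) φ x) + c * |φ x| := by
    rw [differential_mul (hχ x) (hφ x)]
    calc covectorNorm (χ x • differential φ x + φ x • differential χ x)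
        ≤ |χ x| * covectorNorm (differential (n := n) φ x) +
            |φ x| * covectorNorm (differential (n := n) χ x) :=
          (covectorNorm_add_le _ _).trans
            (add_le_add (covectorNorm_smul_le _ _) (covectorNorm_smul_le _ _))
      _ ≤ covectorNorm (differential (n := n) φ x) + c * |φ x| := by
          refine add_le_add (mul_le_of_le_one_left (covectorNorm_nonneg _) (hχ1 x)) ?_
          rw [mul_comm]
          exact mul_le_mul_of_nonneg_right (hdχ x) (abs_nonneg _)
  refine (eLpNorm_mono_real fun x ↦
    (Real.norm_of_nonneg (covectorNorm_nonneg _)).trans_le (hpoint x)).trans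
    ((eLpNorm_add_le hdφm (hφm.norm.const_smul c) (ENNReal.one_le_ofReal.2 hp)).trans_eq ?_)
  rw [eLpNorm_const_smul, eLpNorm_norm, Real.enorm_eq_ofReal hc]

theorem sobolevInequality_of_forall_hasCompactSupport [BorelSpace M] [ProperSpace M]
    [IsManifold (𝓡 n) ∞ M] [IsRiemannianManifold (𝓡 n) M]
    [IsContinuousRiemannianBundle (EuclideanSpace ℝ (Fin n)) (fun x : M ↦ TangentSpace (𝓡 n) x)]
    (hp : 1 ≤ p) (hα : 0 < α)
    (h : ∀ φ : M → ℝ, ContMDiff (𝓡 n) 𝓘(ℝ, ℝ) ∞ φ → HasCompactSupport φ →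
      SobolevInequality p q α A B φ (differential (n := n) φ))
    {φ : M → ℝ} (hφ : ContMDiff (𝓡 n) 𝓘(ℝ, ℝ) ∞ φ)
    (hφp : MemLp φ (ENNReal.ofReal p) (riemannianVolume n M))
    (hdφ : AEStronglyMeasurable (fun x ↦ covectorNorm (differential (n := n) φ x))
      (riemannianVolume n M)) :
    SobolevInequality p q α A B φ (differential (n := n) φ) := by
  obtain ⟨χ, D, hχ, hχc, hχ1, hχlim, hdχ⟩ := exists_cutoff (n := n) (M := M)
  have hDlim : Tendsto (fun k : ℕ ↦ ENNReal.ofReal (|D| / (k + 1)) *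
      eLpNorm φ (ENNReal.ofReal p) (riemannianVolume n M)) atTop (𝓝 0) := by
    have hreal : Tendsto (fun k : ℕ ↦ |D| / ((k : ℝ) + 1)) atTop (𝓝 0) := by
      simpa [Function.comp_def] using
        (tendsto_const_div_atTop_nhds_zero_nat |D|).comp (tendsto_add_atTop_nat 1)
    simpa using ENNReal.Tendsto.mul_const (ENNReal.tendsto_ofReal hreal) (.inr hφp.2.ne)
  refine .of_tendsto hα (fun k ↦ h _ ((hχ k).mul hφ) (hχc k).mul_right)
    (fun k ↦ ((hχ k).continuous.mul hφ.continuous).aestronglyMeasurable) (.of_forall fun x ↦ ?_)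
    (fun k ↦ ?_) tendsto_const_nhds (fun k ↦ ?_) hDlim
  · refine tendsto_const_nhds.congr' ?_
    filter_upwards [hχlim x] with k hk
    rw [Pi.mul_apply, hk, one_mul]
  · rw [add_zero]
    refine eLpNorm_mono fun x ↦ ?_
    rw [Pi.mul_apply, norm_mul]
    exact mul_le_of_le_one_left (norm_nonneg _) (hχ1 k x)
  · exact eLpNorm_covectorNorm_differential_mul_le hp (by positivity)
      ((hχ k).mdifferentiable (by simp)) (hφ.mdifferentiable (by simp)) (hχ1 k)
      (fun x ↦ (hdχ k x).trans (by gcongr; exact le_abs_self D)) hφp.1 hdφ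

theorem MemW.aestronglyMeasurable_covectorNorm (hp : 0 < p) (hu : MemW p u X) :
    AEStronglyMeasurable (fun x ↦ covectorNorm (X x)) (riemannianVolume n M) := by
  obtain ⟨-, φ, hφ, -, hXm, -, hXlim⟩ := hu
  have hmeas : TendstoInMeasure (riemannianVolume n M)
      (fun j x ↦ covectorNorm (X x - differential (φ j) x)) atTop fun _ ↦ (0 : ℝ) :=
    tendstoInMeasure_of_tendsto_eLpNorm (ENNReal.ofReal_pos.2 hp).ne' hXm
      aestronglyMeasurable_const (by simpa only [Pi.sub_def, sub_zero] using hXlim)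
  obtain ⟨ns, -, hns⟩ := hmeas.exists_seq_tendsto_ae
  refine aestronglyMeasurable_of_tendsto_ae atTop (fun j ↦ (hφ (ns j)).2.1) ?_
  filter_upwards [hns] with x hx
  rw [tendsto_iff_norm_sub_tendsto_zero]
  refine squeeze_zero (fun j ↦ norm_nonneg _) (fun j ↦ ?_) hx
  rw [norm_sub_rev]
  exact abs_covectorNorm_sub_le _ _

theorem sobolevInequality_of_memW (hp : 1 ≤ p) (hα : 0 < α)
    (h : ∀ φ : M → ℝ, ContMDiff (𝓡 n) 𝓘(ℝ, ℝ) ∞ φ →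
      MemLp φ (ENNReal.ofReal p) (riemannianVolume n M) →
      MemLp (fun x ↦ covectorNorm (differential (n := n) φ x)) (ENNReal.ofReal p)
        (riemannianVolume n M) → SobolevInequality p q α A B φ (differential (n := n) φ))
    (hu : MemW p u X) : SobolevInequality p q α A B u X := by
  have hp0 : 0 < p := one_pos.trans_le hp
  have hp1 : 1 ≤ ENNReal.ofReal p := ENNReal.one_le_ofReal.2 hp
  have hXm := hu.aestronglyMeasurable_covectorNorm hp0
  obtain ⟨hum, φ, hφS, hφ, hdm, hlim, hdlim⟩ := hu
  have hmeas : TendstoInMeasure (riemannianVolume n M) φ atTop u :=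
    tendstoInMeasure_of_tendsto_eLpNorm (ENNReal.ofReal_pos.2 hp0).ne' (fun j ↦ (hφS j).1.1) hum
      (hlim.congr fun j ↦ eLpNorm_sub_comm u (φ j) _ _)
  obtain ⟨ns, hns, hae⟩ := hmeas.exists_seq_tendsto_ae
  refine .of_tendsto hα (fun j ↦ h _ (hφ (ns j)) (hφS _).1 (hφS _).2) (fun j ↦ (hφS _).1.1) hae
    (fun j ↦ ?_) (hlim.comp hns.tendsto_atTop) (fun j ↦ ?_) (hdlim.comp hns.tendsto_atTop)
  · simpa only [sub_sub_cancel] using! eLpNorm_sub_le hum (hum.sub (hφS (ns j)).1.1) hp1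
  · refine (eLpNorm_mono_real fun x ↦ ?_).trans (eLpNorm_add_le hXm (hdm (ns j)) hp1)
    rw [Real.norm_of_nonneg (covectorNorm_nonneg _), Pi.add_apply]
    linarith [(abs_le.1 (abs_covectorNorm_sub_le (X x) (differential (φ (ns j)) x))).1]

end Sobolev

theorem isContinuousRiemannianBundle_of_isContMDiffRiemannianBundle {EB HB B F : Type*}
    [NormedAddCommGroup EB] [NormedSpace ℝ EB] [TopologicalSpace HB] (I : ModelWithCorners ℝ EB HB)
    (k : ℕ∞ω) [TopologicalSpace B] [ChartedSpace HB B] [NormedAddCommGroup F] [NormedSpace ℝ F]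
    (V : B → Type*) [TopologicalSpace (Bundle.TotalSpace F V)] [∀ x, NormedAddCommGroup (V x)]
    [∀ x, InnerProductSpace ℝ (V x)] [FiberBundle F V] [VectorBundle ℝ F V]
    [h : IsContMDiffRiemannianBundle I k F V] : IsContinuousRiemannianBundle F V := by
  obtain ⟨g, hg, hgnorm⟩ := h.exists_contMDiff
  exact ⟨g, hg.continuous, hgnorm⟩

end RiemannianSobolev

end

open RiemannianSobolev in
theorem theorem6p1_general {n : ℕ} {M : Type*} [MetricSpace M] [CompleteSpace M]
    [MeasurableSpace M] [BorelSpace M] [ChartedSpace (EuclideanSpace ℝ (Fin n)) M]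
    [IsManifold (𝓡 n) ∞ M] [Bundle.RiemannianBundle (fun x : M ↦ TangentSpace (𝓡 n) x)]
    [IsContinuousRiemannianBundle (EuclideanSpace ℝ (Fin n)) (fun x : M ↦ TangentSpace (𝓡 n) x)]
    [IsRiemannianManifold (𝓡 n) M] {p q α A : ℝ} (hp : 1 ≤ p) (hpq : p ≤ q) (hα : 0 < α)
    (hα1 : α ≤ 1) (h : SobolevForSmallVolumes n M p q α A) : SobolevGlobally n M p q α A := by
  have : LocallyCompactSpace M := ChartedSpace.locallyCompactSpace (EuclideanSpace ℝ (Fin n)) M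
  have : ProperSpace M := (hasApproxIntermediatePoints (𝓡 n) M).properSpace
  obtain ⟨τ, hτ, B, hB, hsmall⟩ := h
  refine ⟨B + ((6 * τ ^ (-(1 / p))) ^ ((q - p) / q)) ^ α, by positivity, fun u X hu ↦ ?_⟩
  refine sobolevInequality_of_memW hp hα (fun φ hφ hφp hdφ ↦ ?_) hu
  refine sobolevInequality_of_forall_hasCompactSupport hp hα (fun ψ hψ hψc ↦ ?_) hφ hφp hdφ.1
  exact sobolevInequality_of_hasCompactSupport hp hpq hα hα1 hτ hB hsmall hψ hψc

theorem theorem6p1 {n : ℕ} (hn : 2 ≤ n) {M : Type*} [MetricSpace M] [CompleteSpace M]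
    [SecondCountableTopology M] [MeasurableSpace M] [BorelSpace M]
    [ChartedSpace (EuclideanSpace ℝ (Fin n)) M] [IsManifold (𝓡 n) ∞ M]
    [Bundle.RiemannianBundle (fun x : M ↦ TangentSpace (𝓡 n) x)]
    [IsContMDiffRiemannianBundle (𝓡 n) ∞ (EuclideanSpace ℝ (Fin n))
      (fun x : M ↦ TangentSpace (𝓡 n) x)]
    [IsRiemannianManifold (𝓡 n) M]
    (p q α A : ℝ) (hp : 1 ≤ p) (hpn : p < n) (hq : q = n * p / (n - p))
    (hα : 0 < α) (hα1 : α ≤ 1) (hA : 0 < A)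
    (h : RiemannianSobolev.SobolevForSmallVolumes n M p q α A) :
    RiemannianSobolev.SobolevGlobally n M p q α A := by
  have : IsContinuousRiemannianBundle (EuclideanSpace ℝ (Fin n))
      (fun x : M ↦ TangentSpace (𝓡 n) x) :=
    RiemannianSobolev.isContinuousRiemannianBundle_of_isContMDiffRiemannianBundle (𝓡 n) ∞ _
  have hpq : p ≤ q := by
    rw [hq, le_div_iff₀ (by linarith)]
    nlinarith
  exact theorem6p1_general hp hpq hα hα1 h
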